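/- Notation. For $f\in L^2(\mathbb R)$ let $V_gf(u,v)=\int_{\mathbb R} f(t)\,\overline{e^{2\pi i v t}g(t-u)}\,dt$ be the Gabor transform, with the Gaussian window $g(t)=2^{1/4}e^{-\pi t^2}$; for a tempered distribution $f\in\mathcal S'(\mathbb R)$ let $V_gf(u,v)$ be the value of $f$ at the test function $t\mapsto\overline{e^{2\pi i v t}g(t-u)}$. For $k\in\mathbb N=\{0,1,2,\dots\}$ let $$h_k(x)=\frac{(-1)^k}{\sqrt{2^{2k-1/2}\pi^k k!}}\,e^{\pi x^2}\frac{d^k}{dx^k}e^{-2\pi x^2}$$ be the $L^2(\mathbb R)$-normalized Hermite function, and put $p_k=\prod_{t=1}^k\sqrt{k/(et)}$. Let $\xi$ be a real Gaussian white noise, that is, a random real tempered distribution whose law satisfies $\mathbb E\,e^{i\langle\xi,\varphi\rangle}=e^{-\|\varphi\|_{L^2}^2/2}$ for all real Schwartz functions $\varphi$. For $L>0$ let $\mathbb B_L=\{u+iv:\max\{|u|,|v|\}\le L\}$. For $y\in\mathcal S'(\mathbb R)$ and $\gamma\in\mathbb R$ let $\Lambda(\gamma)=\{(u,v)\in\mathbb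 R^2: u+iv\in\mathbb B_L,\ |V_gy(u,v)|\ge\gamma\}$. Theorem. There is a universal constant $K>0$ with the following two properties. (i) For all $L\ge\pi$ and $\tau>0$, with probability at least $1-4\exp\left(-\frac{\tau^2}{2\pi}\log L\right)$, $$\sup_{u+iv\in\mathbb B_L}|V_g\xi(u,v)|\le\sqrt2\,(14K+\tau)\sqrt{\log L}.$$ (ii) Let $k\in\mathbb N$, $\tau>0$, $L\ge\max\{\sqrt{k/\pi},\pi\}$, and let $\lambda\in\mathbb R$ satisfy $$|\lambda|\ge\frac{5\sqrt2\,(14K+\tau)\sqrt{\log L}}{p_k}.$$ Let $y=\lambda h_k+\xi$ and $$\alpha=\frac{\sqrt2\,(14K+\tau)\sqrt{\log L}}{|\lambda|\,p_k}.$$ Then $\alpha\in(0,\tfrac15]$ and, with probability at least $1-4\exp\left(-\frac{\tau^2}{2\pi}\log L\right)$, $$\emptyset\ne\Lambda\left(3\sqrt2\,(14K+\tau)\sqrt{\log L}\right)\subseteq\left\{(u,v)\in\mathbb R^2:\frac{|V_gh_k(u,v)|}{p_k}>\alpha\right\}.$$ -/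

import Mathlib

open MeasureTheory
open scoped SchwartzMap

noncomputable section

namespace Gabor

/-! ### Analytic helper facts: polynomials times Gaussians are Schwartz functions -/

theorem hasDerivAt_poly_gauss (a : ℝ) (p : Polynomial ℝ) (x : ℝ) :
    HasDerivAt (fun x : ℝ => p.eval x * Real.exp (-(a * x ^ 2)))
      ((p.derivative - Polynomial.C (2 * a) * Polynomial.X * p).eval x *
        Real.exp (-(a * x ^ 2))) x := by
  have h1 := p.hasDerivAt x
  have h2 : HasDerivAt (fun x : ℝ => -(a * x ^ 2)) (-(a * (2 * x))) x := by
    have := ((hasDerivAt_pow 2 x).const_mul a).neg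
    refine this.congr_deriv ?_
    simp
  have h3 := h1.mul h2.exp
  refine h3.congr_deriv ?_
  simp only [Polynomial.eval_sub, Polynomial.eval_mul, Polynomial.eval_C, Polynomial.eval_X]
  ring

theorem exists_iteratedDeriv_poly_gauss (a : ℝ) (p : Polynomial ℝ) (n : ℕ) :
    ∃ q : Polynomial ℝ, iteratedDeriv n (fun x : ℝ => p.eval x * Real.exp (-(a * x ^ 2))) =
      fun x : ℝ => q.eval x * Real.exp (-(a * x ^ 2)) := by
  induction n with
  | zero => exact ⟨p, by simp⟩
  | succ n ih =>
    obtain ⟨q, hq⟩ := ih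
    refine ⟨q.derivative - Polynomial.C (2 * a) * Polynomial.X * q, ?_⟩
    rw [iteratedDeriv_succ, hq]
    funext x
    exact (hasDerivAt_poly_gauss a q x).deriv

theorem poly_gauss_bounded {a : ℝ} (ha : 0 < a) (p : Polynomial ℝ) :
    ∃ C : ℝ, ∀ x : ℝ, |p.eval x * Real.exp (-(a * x ^ 2))| ≤ C := by
  induction p using Polynomial.induction_on' with
  | add p q hp hq =>
    obtain ⟨C, hC⟩ := hp
    obtain ⟨D, hD⟩ := hq
    refine ⟨C + D, fun x => ?_⟩
    rw [Polynomial.eval_add, add_mul]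
    exact (abs_add_le _ _).trans (add_le_add (hC x) (hD x))
  | monomial n c =>
    refine ⟨|c| * (1 + n.factorial / a ^ n), fun x => ?_⟩
    rw [Polynomial.eval_monomial, mul_assoc, abs_mul]
    refine mul_le_mul_of_nonneg_left ?_ (abs_nonneg c)
    rw [abs_mul, abs_of_pos (Real.exp_pos _), abs_pow]
    have h1 : |x| ^ n ≤ 1 + (x ^ 2) ^ n := by
      rw [← sq_abs x, ← pow_mul, mul_comm 2 n, pow_mul]
      nlinarith [sq_nonneg (|x| ^ n - 1), pow_nonneg (abs_nonneg x) n]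
    have h2 : (a * x ^ 2) ^ n / n.factorial ≤ Real.exp (a * x ^ 2) :=
      Real.pow_div_factorial_le_exp _ (by positivity) n
    have h3 : (x ^ 2) ^ n ≤ n.factorial / a ^ n * Real.exp (a * x ^ 2) := by
      rw [div_le_iff₀ (by positivity), mul_pow] at h2
      rw [div_mul_eq_mul_div, le_div_iff₀ (by positivity)]
      linarith
    have h4 : (1 : ℝ) ≤ Real.exp (a * x ^ 2) := Real.one_le_exp (by positivity)
    rw [Real.exp_neg, ← div_eq_mul_inv, div_le_iff₀ (Real.exp_pos _)]
    linarith

/-- The Schwartz function `x ↦ p(x) e^{-a x²}` for a real polynomial `p` and `a > 0`. -/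
def polyGauss (a : ℝ) (ha : 0 < a) (p : Polynomial ℝ) : 𝓢(ℝ, ℝ) where
  toFun x := p.eval x * Real.exp (-(a * x ^ 2))
  smooth' := by
    have h : ContDiff ℝ (⊤ : ℕ∞) (fun x : ℝ => p.eval x) := by
      simpa using p.contDiff_aeval (𝕜 := ℝ) (⊤ : ℕ∞)
    exact h.mul (by fun_prop)
  decay' k n := by
    obtain ⟨q, hq⟩ := exists_iteratedDeriv_poly_gauss a p n
    obtain ⟨C, hC⟩ := poly_gauss_bounded ha (Polynomial.X ^ k * q)
    refine ⟨C, fun x => ?_⟩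
    rw [norm_iteratedFDeriv_eq_norm_iteratedDeriv, hq]
    have := hC x
    rw [Polynomial.eval_mul, Polynomial.eval_pow, Polynomial.eval_X, mul_assoc, abs_mul,
      abs_pow] at this
    simpa only [Real.norm_eq_abs] using this

theorem polyGauss_apply (a : ℝ) (ha : 0 < a) (p : Polynomial ℝ) (x : ℝ) :
    polyGauss a ha p x = p.eval x * Real.exp (-(a * x ^ 2)) := rfl

/-- A real valued Schwartz function, seen as a complex valued one. -/
def toComplex (f : 𝓢(ℝ, ℝ)) : 𝓢(ℝ, ℂ) := SchwartzMap.postcompCLM Complex.ofRealCLM f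

theorem toComplex_apply (f : 𝓢(ℝ, ℝ)) (x : ℝ) : toComplex f x = (f x : ℂ) := rfl

/-! ### The short-time Fourier transform -/

/-- The time-frequency shift `M_v T_u φ`, i.e. `t ↦ e^{2π i v t} φ (t - u)`. -/
def timeFreqShift (u v : ℝ) (φ : ℝ → ℂ) (t : ℝ) : ℂ :=
  Complex.exp (2 * Real.pi * Complex.I * v * t) * φ (t - u)

/-- The short-time Fourier transform `V_φ f (u, v) = ⟨f, M_v T_u φ⟩ = ∫ f conj(M_v T_u φ)` of a
function `f ∈ L²(ℝ)` with respect to a window `φ ∈ L²(ℝ)`. -/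
def stft (φ f : ℝ → ℂ) (u v : ℝ) : ℂ :=
  ∫ t : ℝ, f t * (starRingEnd ℂ) (timeFreqShift u v φ t)

theorem hasTemperateGrowth_modulation (v : ℝ) :
    Function.HasTemperateGrowth
      (fun t : ℝ => Complex.exp (2 * Real.pi * Complex.I * v * t)) := by
  have key : ∀ n : ℕ,
      iteratedDeriv n (fun t : ℝ => Complex.exp (2 * Real.pi * Complex.I * v * t)) =
        fun t : ℝ => (2 * Real.pi * Complex.I * v) ^ n *
          Complex.exp (2 * Real.pi * Complex.I * v * t) := by
    intro n
    induction n with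
    | zero => simp
    | succ n ih =>
      rw [iteratedDeriv_succ, ih]
      funext t
      have h1 : HasDerivAt (fun t : ℝ => (2 * Real.pi * Complex.I * v : ℂ) * (t : ℂ))
          (2 * Real.pi * Complex.I * v) t := by
        simpa using (Complex.ofRealCLM.hasDerivAt (x := t)).const_mul
          (2 * Real.pi * Complex.I * v : ℂ)
      have h2 := (h1.cexp.const_mul ((2 * Real.pi * Complex.I * v : ℂ) ^ n)).deriv
      rw [h2]
      ring
  refine ⟨?_, fun n => ⟨0, ‖(2 * Real.pi * Complex.I * v : ℂ) ^ n‖, fun t => ?_⟩⟩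
  · have : ContDiff ℝ (⊤ : ℕ∞) (fun t : ℝ => (t : ℂ)) := Complex.ofRealCLM.contDiff
    fun_prop
  · rw [norm_iteratedFDeriv_eq_norm_iteratedDeriv, key n]
    have h : ‖Complex.exp (2 * Real.pi * Complex.I * v * t)‖ = 1 := by
      rw [Complex.norm_exp]
      simp
    simp [h]

/-- The time-frequency shift `M_v T_u φ` of a Schwartz function, as a Schwartz function. -/
def timeFreqShiftSchwartz (u v : ℝ) (φ : 𝓢(ℝ, ℂ)) : 𝓢(ℝ, ℂ) :=
  SchwartzMap.smulLeftCLM ℂ (fun t : ℝ => Complex.exp (2 * Real.pi * Complex.I * v * t))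
    (SchwartzMap.compSubConstCLM ℂ u φ)

theorem timeFreqShiftSchwartz_apply (u v : ℝ) (φ : 𝓢(ℝ, ℂ)) (t : ℝ) :
    timeFreqShiftSchwartz u v φ t = timeFreqShift u v φ t := by
  simp [timeFreqShiftSchwartz, timeFreqShift,
    SchwartzMap.smulLeftCLM_apply_apply (hasTemperateGrowth_modulation v)]

/-- Pointwise complex conjugation of a Schwartz function. -/
def conjSchwartz (φ : 𝓢(ℝ, ℂ)) : 𝓢(ℝ, ℂ) :=
  SchwartzMap.postcompCLM (Complex.conjCLE : ℂ →L[ℝ] ℂ) φ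

theorem conjSchwartz_apply (φ : 𝓢(ℝ, ℂ)) (t : ℝ) :
    conjSchwartz φ t = (starRingEnd ℂ) (φ t) := rfl

/-- The short-time Fourier transform `V_φ f (u, v) = ⟨f, M_v T_u φ⟩` of a tempered distribution
`f` with respect to a Schwartz window `φ`. The bracket is linear in `f` and conjugate linear in the
window, so that this extends the transform of functions. -/
def stftDistribution (φ : 𝓢(ℝ, ℂ)) (f : 𝓢'(ℝ, ℂ)) (u v : ℝ) : ℂ :=
  f (conjSchwartz (timeFreqShiftSchwartz u v φ))

/-- On Schwartz functions, seen as tempered distributions, the two transforms agree. -/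
theorem stftDistribution_coe (φ f : 𝓢(ℝ, ℂ)) (u v : ℝ) :
    stftDistribution φ (SchwartzMap.toTemperedDistributionCLM ℝ ℂ volume f) u v =
      stft φ f u v := by
  simp only [stftDistribution, stft, SchwartzMap.toTemperedDistributionCLM_apply_apply,
    conjSchwartz_apply, timeFreqShiftSchwartz_apply, smul_eq_mul]
  exact integral_congr_ae (Filter.Eventually.of_forall fun t => mul_comm _ _)

/-! ### The Gaussian window and the Hermite functions -/

/-- The Gaussian window `g(t) = 2^{1/4} e^{-π t²}`, as a Schwartz function. -/
def gaussWindow : 𝓢(ℝ, ℂ) :=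
  toComplex (polyGauss Real.pi Real.pi_pos (Polynomial.C ((2 : ℝ) ^ (1 / 4 : ℝ))))

theorem gaussWindow_apply (t : ℝ) :
    gaussWindow t = (((2 : ℝ) ^ (1 / 4 : ℝ) * Real.exp (-(Real.pi * t ^ 2)) : ℝ) : ℂ) := by
  rw [gaussWindow, toComplex_apply, polyGauss_apply, Polynomial.eval_C]

/-- The `L²(ℝ)`-normalized Hermite function
`h_k(x) = (-1)^k (2^{2k - 1/2} π^k k!)^{-1/2} e^{π x²} (d/dx)^k e^{-2π x²}`. -/
def hermiteFun (k : ℕ) (x : ℝ) : ℝ :=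
  (-1) ^ k / Real.sqrt ((2 : ℝ) ^ (2 * (k : ℝ) - 1 / 2) * Real.pi ^ k * k.factorial) *
    Real.exp (Real.pi * x ^ 2) *
    iteratedDeriv k (fun t : ℝ => Real.exp (-(2 * Real.pi * t ^ 2))) x

theorem exists_hermiteSchwartz (k : ℕ) : ∃ f : 𝓢(ℝ, ℝ), ∀ x, f x = hermiteFun k x := by
  obtain ⟨q, hq⟩ := exists_iteratedDeriv_poly_gauss (2 * Real.pi) 1 k
  simp only [Polynomial.eval_one, one_mul] at hq
  refine ⟨polyGauss Real.pi Real.pi_pos (Polynomial.C ((-1) ^ k /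
    Real.sqrt ((2 : ℝ) ^ (2 * (k : ℝ) - 1 / 2) * Real.pi ^ k * k.factorial)) * q), fun x => ?_⟩
  rw [polyGauss_apply, hermiteFun, hq, Polynomial.eval_mul, Polynomial.eval_C]
  have : Real.exp (-(2 * Real.pi * x ^ 2)) =
      Real.exp (-(Real.pi * x ^ 2)) * Real.exp (-(Real.pi * x ^ 2)) := by
    rw [← Real.exp_add]; ring_nf
  simp only [this, Real.exp_neg]
  have := (Real.exp_pos (Real.pi * x ^ 2)).ne'
  field_simp

/-- The Hermite function `h_k` as a complex valued Schwartz function. -/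
def hermiteSchwartz (k : ℕ) : 𝓢(ℝ, ℂ) := toComplex (exists_hermiteSchwartz k).choose

theorem hermiteSchwartz_apply (k : ℕ) (x : ℝ) :
    hermiteSchwartz k x = (hermiteFun k x : ℂ) := by
  rw [hermiteSchwartz, toComplex_apply, (exists_hermiteSchwartz k).choose_spec]

/-- The Hermite function `h_k` as a tempered distribution. -/
def hermiteDistribution (k : ℕ) : 𝓢'(ℝ, ℂ) :=
  SchwartzMap.toTemperedDistributionCLM ℝ ℂ volume (hermiteSchwartz k)

/-! ### White noise -/

/-- The space of tempered distributions carries its Borel σ-algebra. -/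
instance instMeasurableSpaceTemperedDistribution : MeasurableSpace 𝓢'(ℝ, ℂ) := borel _

instance instBorelSpaceTemperedDistribution : BorelSpace 𝓢'(ℝ, ℂ) := ⟨rfl⟩

/-- The (real) white noise measure on the space of tempered distributions: the probability measure
that is carried by the real tempered distributions (those that take real values at real test
functions) and satisfies `𝔼 e^{i ⟨ξ, φ⟩} = e^{-‖φ‖² / 2}` for real test functions `φ`. -/
structure IsWhiteNoiseMeasure (μ : Measure 𝓢'(ℝ, ℂ)) : Prop where
  isProbabilityMeasure : IsProbabilityMeasure μ
  real : ∀ᵐ ξ ∂μ, ∀ φ : 𝓢(ℝ, ℝ), (ξ (toComplex φ)).im = 0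
  charFun : ∀ φ : 𝓢(ℝ, ℝ),
    ∫ ξ, Complex.exp (Complex.I * ξ (toComplex φ)) ∂μ =
      Complex.exp (-(1 / 2) * ((∫ t : ℝ, φ t ^ 2 : ℝ) : ℂ))

/-- The random tempered distribution `ξ` is a white noise: a random variable whose distribution is
the white noise measure. -/
structure IsWhiteNoise {Ω : Type*} [MeasurableSpace Ω] (P : Measure Ω) (ξ : Ω → 𝓢'(ℝ, ℂ)) :
    Prop where
  measurable : Measurable ξ
  law : IsWhiteNoiseMeasure (P.map ξ)

/-! ### Level sets -/

/-- The box `𝔹_L = {u + i v : max (|u|, |v|) ≤ L}`. -/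
def box (L : ℝ) : Set ℂ := {z | max |z.re| |z.im| ≤ L}

/-- The level set `Λ(γ) = {(u, v) : u + i v ∈ 𝔹_L, |V_g y (u, v)| ≥ γ}`. -/
def levelSet (y : 𝓢'(ℝ, ℂ)) (L γ : ℝ) : Set (ℝ × ℝ) :=
  {p | (p.1 : ℂ) + p.2 * Complex.I ∈ box L ∧ γ ≤ ‖stftDistribution gaussWindow y p.1 p.2‖}

/-- The number `∏_{t=1}^k √(k / (e t))`, which is the maximum of `|V_g h_k|`. -/
def peak (k : ℕ) : ℝ := ∏ t ∈ Finset.Icc 1 k, Real.sqrt (k / (Real.exp 1 * t))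

/-- The event `E` is measurable and has probability at least `p`. -/
def HoldsWithProbAtLeast {Ω : Type*} [MeasurableSpace Ω] (P : Measure Ω) (p : ℝ)
    (E : Ω → Prop) : Prop :=
  MeasurableSet {ω | E ω} ∧ p ≤ P.real {ω | E ω}

end Gabor

end

/-!
The Gabor transform of a tempered distribution `ξ` with Gaussian window is, at `(u, v)`, the
product of `2^{1/4} e^{-π u²}` and of an entire function evaluated at `u - i v`: pair `ξ` with the
holomorphic family of Schwartz functions `t ↦ e^{-π t² + 2 π z t}` (`hasDerivAt_apply_gaussExp`,
`stftDistribution_gaussWindow`). By Jensen's inequality `exp (a |G|²)` is subharmonic for entire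
`G`, so on discs of radius `1 / 4`, where the Gaussian weight is almost the modulus of a holomorphic
function, `exp (a |V_g ξ|²)` at the centre is at most the average of `exp (2 a |V_g ξ|²)`
(`exp_stftDistribution_le_lintegral_ball`). Hence the supremum over a box is controlled by an
integral over a slightly larger region, without chaining or a concentration inequality.

For white noise the real and imaginary parts of `V_g ξ (u, v)` are Gaussian with variance at most
one, so `exp (|V_g ξ|² / 2π)` has expectation at most `2` and Fubini's theorem with Markov's
inequality gives `P (sup |V_g ξ| > s) ≤ 128 L² e^{-s² / 4π}`
(`IsWhiteNoise.measure_exists_box_le`). With `s = √2 (14 K + τ) √(log L)` the exponential is at most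
`L^{-98 K² / π} e^{-(τ² / 2π) log L}`. Since `K` may be any universal constant, `K = 1` is large
enough: the power of `L` absorbs the factor `128 L²`.

On the event that the noise stays below this `s`, the second part is a deterministic consequence of
the triangle inequality and of `|V_g h_k| = p_k` at the point `√(k / π)` of the box
(`norm_stft_hermiteFun_eq_peak`), which follows by integrating by parts `k` times.
-/

noncomputable section

namespace Gabor

/-! ### The Gabor transform of a tempered distribution as an entire function -/

/-- The entire family `z ↦ t ^ n e^{-π t² + 2 π z t}`. For `n = 0` and `z = u - i v` this is, up to
the factor `2^{1/4} e^{-π u²}`, the conjugate of the time-frequency shift of the Gaussian window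
by `(u, v)`; the powers of `t` arise as derivatives in `z`. -/
def gaussExp (n : ℕ) (z : ℂ) (t : ℝ) : ℂ :=
  (t : ℂ) ^ n * Complex.exp (-Real.pi * t ^ 2 + 2 * Real.pi * z * t)

theorem contDiff_gaussExp (n : ℕ) (z : ℂ) : ContDiff ℝ (⊤ : ℕ∞) (gaussExp n z) := by
  have : ContDiff ℝ (⊤ : ℕ∞) (fun t : ℝ => (t : ℂ)) := Complex.ofRealCLM.contDiff
  unfold gaussExp
  fun_prop

theorem hasDerivAt_gaussExp (n : ℕ) (z : ℂ) (t : ℝ) :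
    HasDerivAt (gaussExp n z)
      (n * gaussExp (n - 1) z t - 2 * Real.pi * gaussExp (n + 1) z t +
        2 * Real.pi * z * gaussExp n z t) t := by
  have h : HasDerivAt (fun s : ℂ => s ^ n *
      Complex.exp (-Real.pi * s ^ 2 + 2 * Real.pi * z * s))
      (n * gaussExp (n - 1) z t - 2 * Real.pi * gaussExp (n + 1) z t +
        2 * Real.pi * z * gaussExp n z t) (t : ℂ) := by
    have h1 : HasDerivAt (fun s : ℂ => -Real.pi * s ^ 2 + 2 * Real.pi * z * s)
        (-Real.pi * (2 * t) + 2 * Real.pi * z) (t : ℂ) := by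
      have := ((hasDerivAt_pow 2 (t : ℂ)).const_mul (-Real.pi : ℂ)).fun_add
        ((hasDerivAt_id (t : ℂ)).const_mul (2 * Real.pi * z))
      simpa using this
    refine ((hasDerivAt_pow n (t : ℂ)).mul h1.cexp).congr_deriv ?_
    simp only [gaussExp]
    ring
  exact h.comp_ofReal

theorem iteratedDeriv_succ_gaussExp (m n : ℕ) (z : ℂ) (t : ℝ) :
    iteratedDeriv (m + 1) (gaussExp n z) t =
      n * iteratedDeriv m (gaussExp (n - 1) z) t -
        2 * Real.pi * iteratedDeriv m (gaussExp (n + 1) z) t +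
        2 * Real.pi * z * iteratedDeriv m (gaussExp n z) t := by
  have hc : ∀ j, ContDiffAt ℝ m (gaussExp j z) t := fun j =>
    ((contDiff_gaussExp j z).of_le (by exact_mod_cast le_top)).contDiffAt
  have hd : deriv (gaussExp n z) =
      ((fun t => (n : ℂ) * gaussExp (n - 1) z t) - fun t => 2 * Real.pi * gaussExp (n + 1) z t) +
        fun t => 2 * Real.pi * z * gaussExp n z t :=
    funext fun t => (hasDerivAt_gaussExp n z t).deriv
  have h1 := (contDiffAt_const (c := (n : ℂ))).mul (hc (n - 1))
  have h2 := (contDiffAt_const (c := (2 * Real.pi : ℂ))).mul (hc (n + 1))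
  have h3 := (contDiffAt_const (c := 2 * Real.pi * z)).mul (hc n)
  have h12 : ContDiffAt ℝ m ((fun t => (n : ℂ) * gaussExp (n - 1) z t) -
    fun t => 2 * Real.pi * gaussExp (n + 1) z t) t := h1.sub h2
  rw [iteratedDeriv_succ', hd, iteratedDeriv_add h12 h3, iteratedDeriv_sub h1 h2]
  simp only [iteratedDeriv_const_mul_field]

theorem norm_gaussExp (n : ℕ) (z : ℂ) (t : ℝ) :
    ‖gaussExp n z t‖ = |t| ^ n * Real.exp (-(Real.pi * t ^ 2) + 2 * Real.pi * z.re * t) := by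
  rw [gaussExp, norm_mul, norm_pow, Complex.norm_real, Complex.norm_exp, Real.norm_eq_abs]
  congr 2
  have : (-Real.pi * t ^ 2 + 2 * Real.pi * z * t : ℂ) =
      ((-Real.pi * t ^ 2 : ℝ) : ℂ) + ((2 * Real.pi * t : ℝ) : ℂ) * z := by push_cast; ring
  rw [this, Complex.add_re, Complex.ofReal_re, Complex.re_ofReal_mul]
  ring

/-- All Schwartz seminorms of `gaussExp n z` are bounded locally uniformly in `z`. -/
theorem exists_bound_gaussExp (m : ℕ) : ∀ (k n : ℕ) (R : ℝ), ∃ C : ℝ, ∀ z : ℂ, ‖z‖ ≤ R →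
    ∀ t : ℝ, |t| ^ k * ‖iteratedDeriv m (gaussExp n z) t‖ ≤ C := by
  induction m with
  | zero =>
    intro k n R
    obtain ⟨C, hC⟩ := poly_gauss_bounded (a := Real.pi / 2) (by positivity)
      (Polynomial.X ^ (k + n) : Polynomial ℝ)
    refine ⟨C * Real.exp (2 * Real.pi * R ^ 2), fun z hz t => ?_⟩
    have h := hC t
    rw [Polynomial.eval_pow, Polynomial.eval_X, abs_mul, abs_pow,
      abs_of_pos (Real.exp_pos _)] at h
    rw [iteratedDeriv_zero, norm_gaussExp, ← mul_assoc, ← pow_add]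
    have hz2 : z.re ^ 2 ≤ R ^ 2 :=
      sq_le_sq' (by linarith [neg_abs_le z.re, Complex.abs_re_le_norm z])
        ((Complex.re_le_norm z).trans hz)
    -- complete the square: `2 z t ≤ t² / 2 + 2 z²`
    have h1 : -(Real.pi * t ^ 2) + 2 * Real.pi * z.re * t ≤
        -(Real.pi / 2 * t ^ 2) + 2 * Real.pi * R ^ 2 := by
      nlinarith [mul_nonneg Real.pi_pos.le (sq_nonneg (t - 2 * z.re)),
        mul_le_mul_of_nonneg_left hz2 Real.pi_pos.le]
    calc |t| ^ (k + n) * Real.exp (-(Real.pi * t ^ 2) + 2 * Real.pi * z.re * t)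
        ≤ |t| ^ (k + n) * Real.exp (-(Real.pi / 2 * t ^ 2) + 2 * Real.pi * R ^ 2) := by gcongr
      _ = |t| ^ (k + n) * Real.exp (-(Real.pi / 2 * t ^ 2)) * Real.exp (2 * Real.pi * R ^ 2) := by
        rw [Real.exp_add]; ring
      _ ≤ _ := by gcongr
  | succ m ih =>
    intro k n R
    obtain ⟨A, hA⟩ := ih k (n - 1) R
    obtain ⟨B, hB⟩ := ih k (n + 1) R
    obtain ⟨D, hD⟩ := ih k n R
    refine ⟨n * A + 2 * Real.pi * B + 2 * Real.pi * R * D, fun z hz t => ?_⟩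
    have hA := hA z hz t
    have hB := hB z hz t
    have hD := hD z hz t
    have hR : 0 ≤ R := (norm_nonneg z).trans hz
    have hD0 : 0 ≤ D := le_trans (by positivity) hD
    rw [iteratedDeriv_succ_gaussExp]
    have h1 : ‖(n * iteratedDeriv m (gaussExp (n - 1) z) t -
        2 * Real.pi * iteratedDeriv m (gaussExp (n + 1) z) t +
        2 * Real.pi * z * iteratedDeriv m (gaussExp n z) t : ℂ)‖ ≤
        n * ‖iteratedDeriv m (gaussExp (n - 1) z) t‖ +
        2 * Real.pi * ‖iteratedDeriv m (gaussExp (n + 1) z) t‖ +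
        2 * Real.pi * ‖z‖ * ‖iteratedDeriv m (gaussExp n z) t‖ := by
      refine (norm_add_le _ _).trans (add_le_add ((norm_sub_le _ _).trans_eq ?_) (le_of_eq ?_)) <;>
      simp [abs_of_pos Real.pi_pos]
    refine (mul_le_mul_of_nonneg_left h1 (by positivity : 0 ≤ |t| ^ k)).trans ?_
    calc _ = n * (|t| ^ k * ‖iteratedDeriv m (gaussExp (n - 1) z) t‖) +
          2 * Real.pi * (|t| ^ k * ‖iteratedDeriv m (gaussExp (n + 1) z) t‖) +
          2 * Real.pi * ‖z‖ * (|t| ^ k * ‖iteratedDeriv m (gaussExp n z) t‖) := by ring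
      _ ≤ _ := by
        have := Real.pi_pos
        gcongr

/-- Differentiation in `t` commutes with differentiation in `z`, which is multiplication by
`2 π t`. -/
theorem hasDerivAt_iteratedDeriv_gaussExp (m : ℕ) (t : ℝ) : ∀ (n : ℕ) (z : ℂ),
    HasDerivAt (fun z => iteratedDeriv m (gaussExp n z) t)
      (2 * Real.pi * iteratedDeriv m (gaussExp (n + 1) z) t) z := by
  induction m with
  | zero =>
    intro n z
    simp only [iteratedDeriv_zero, gaussExp]
    have h1 : HasDerivAt (fun z : ℂ => -Real.pi * (t : ℂ) ^ 2 + 2 * Real.pi * z * t)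
        (2 * Real.pi * t : ℂ) z := by
      simpa using (((hasDerivAt_id z).const_mul (2 * Real.pi : ℂ)).mul_const (t : ℂ)).const_add
        (-Real.pi * (t : ℂ) ^ 2)
    refine (h1.cexp.const_mul ((t : ℂ) ^ n)).congr_deriv ?_
    ring
  | succ m ih =>
    intro n z
    simp only [iteratedDeriv_succ_gaussExp]
    have h := (((ih (n - 1) z).const_mul (n : ℂ)).sub
      ((ih (n + 1) z).const_mul (2 * Real.pi : ℂ))).add
      ((((hasDerivAt_id z).const_mul (2 * Real.pi : ℂ)).mul (ih n z)))
    refine h.congr_deriv ?_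
    rcases n with _ | n
    · simp; ring
    · simp; ring

/-- The function `gaussExp n z` as a Schwartz function. -/
def gaussExpSchwartz (n : ℕ) (z : ℂ) : 𝓢(ℝ, ℂ) where
  toFun := gaussExp n z
  smooth' := contDiff_gaussExp n z
  decay' k m := by
    obtain ⟨C, hC⟩ := exists_bound_gaussExp m k n ‖z‖
    refine ⟨C, fun t => ?_⟩
    rw [norm_iteratedFDeriv_eq_norm_iteratedDeriv, Real.norm_eq_abs]
    exact hC z le_rfl t

theorem gaussExpSchwartz_apply (n : ℕ) (z : ℂ) (t : ℝ) :
    gaussExpSchwartz n z t = gaussExp n z t := rfl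

theorem coe_gaussExpSchwartz (n : ℕ) (z : ℂ) : ⇑(gaussExpSchwartz n z) = gaussExp n z := rfl

/-- A quantitative first order Taylor expansion on a disc where the second derivative is bounded. -/
theorem norm_sub_sub_le_of_hasDerivAt {f f' f'' : ℂ → ℂ} {C : ℝ} {z w : ℂ}
    (hf : ∀ y, HasDerivAt f (f' y) y) (hf' : ∀ y, HasDerivAt f' (f'' y) y)
    (hC : ∀ y ∈ Metric.closedBall z ‖w - z‖, ‖f'' y‖ ≤ C) :
    ‖f w - f z - (w - z) * f' z‖ ≤ C * ‖w - z‖ ^ 2 := by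
  have hz : z ∈ Metric.closedBall z ‖w - z‖ := by simp
  have hw : w ∈ Metric.closedBall z ‖w - z‖ := by simp [dist_eq_norm]
  have hconv := convex_closedBall z ‖w - z‖
  have hC0 : 0 ≤ C := (norm_nonneg _).trans (hC z hz)
  have h1 : ∀ y ∈ Metric.closedBall z ‖w - z‖, ‖f' y - f' z‖ ≤ C * ‖w - z‖ := fun y hy => by
    refine (hconv.norm_image_sub_le_of_norm_hasDerivWithin_le
      (fun x _ => (hf' x).hasDerivWithinAt) hC hz hy).trans ?_
    rw [Metric.mem_closedBall, dist_eq_norm] at hy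
    gcongr
  have h2 := hconv.norm_image_sub_le_of_norm_hasDerivWithin_le
    (f := fun y => f y - y * f' z) (f' := fun y => f' y - f' z)
    (fun x _ => by
      have := ((hf x).fun_sub ((hasDerivAt_id x).mul_const (f' z))).hasDerivWithinAt
        (s := Metric.closedBall z ‖w - z‖)
      simpa using this) h1 hz hw
  calc _ = ‖f w - w * f' z - (f z - z * f' z)‖ := by congr 1; ring
    _ ≤ _ := h2
    _ = _ := by ring

/-- Every continuous linear functional on the Schwartz space turns the family `gaussExp` into
an entire function. -/
theorem hasDerivAt_apply_gaussExp (ξ : 𝓢'(ℝ, ℂ)) (n : ℕ) (z : ℂ) :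
    HasDerivAt (fun z => ξ (gaussExpSchwartz n z))
      (ξ ((2 * Real.pi : ℂ) • gaussExpSchwartz (n + 1) z)) z := by
  obtain ⟨s, C, -, hC⟩ := Seminorm.bound_of_continuous (schwartz_withSeminorms ℂ ℝ ℂ)
    ((normSeminorm ℂ ℂ).comp (ContinuousLinearMap.toLinearMap (ξ : 𝓢(ℝ, ℂ) →L[ℂ] ℂ)))
    (continuous_norm.comp (ContinuousLinearMap.continuous (ξ : 𝓢(ℝ, ℂ) →L[ℂ] ℂ)))
  choose M hM using fun i : ℕ × ℕ => exists_bound_gaussExp i.2 i.1 (n + 2) (‖z‖ + 1)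
  rw [hasDerivAt_iff_isLittleO]
  refine Asymptotics.IsBigO.trans_isLittleO (g := fun w => ‖w - z‖ ^ 2) ?_
    (Asymptotics.isLittleO_pow_sub_sub z one_lt_two)
  refine Asymptotics.IsBigO.of_bound (C * ∑ i ∈ s, (2 * Real.pi) ^ 2 * M i) ?_
  filter_upwards [Metric.ball_mem_nhds z one_pos] with w hw
  rw [Metric.mem_ball, dist_eq_norm] at hw
  set q : 𝓢(ℝ, ℂ) := gaussExpSchwartz n w - gaussExpSchwartz n z -
    (w - z) • ((2 * Real.pi : ℂ) • gaussExpSchwartz (n + 1) z) with hq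
  have hM0 : ∀ i, 0 ≤ M i := fun i =>
    le_trans (by positivity) (hM i z (by linarith) 0)
  -- each Schwartz seminorm of the Taylor remainder is quadratically small
  have hsemi : ∀ i : ℕ × ℕ, schwartzSeminormFamily ℂ ℝ ℂ i q ≤
      (2 * Real.pi) ^ 2 * M i * ‖w - z‖ ^ 2 := by
    intro i
    refine SchwartzMap.seminorm_le_bound' ℂ i.1 i.2 q
      (by have := hM0 i; positivity) fun t => ?_
    have hsm : ∀ f : 𝓢(ℝ, ℂ), ContDiffAt ℝ i.2 (⇑f) t := fun f => (f.smooth i.2).contDiffAt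
    have hqt : iteratedDeriv i.2 q t = iteratedDeriv i.2 (gaussExp n w) t -
        iteratedDeriv i.2 (gaussExp n z) t -
        (w - z) * (2 * Real.pi * iteratedDeriv i.2 (gaussExp (n + 1) z) t) := by
      have e : (q : ℝ → ℂ) = (⇑(gaussExpSchwartz n w) - ⇑(gaussExpSchwartz n z)) -
          fun t => (w - z) * (2 * Real.pi * gaussExp (n + 1) z t) := rfl
      have h3 : ContDiffAt ℝ i.2 (fun t => (w - z) * (2 * Real.pi * gaussExp (n + 1) z t)) t :=
        contDiffAt_const.mul (contDiffAt_const.mul (hsm (gaussExpSchwartz (n + 1) z)))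
      have h12 : ContDiffAt ℝ i.2 (⇑(gaussExpSchwartz n w) - ⇑(gaussExpSchwartz n z)) t :=
        (hsm _).sub (hsm _)
      rw [e, iteratedDeriv_sub h12 h3, iteratedDeriv_sub (hsm _) (hsm _)]
      simp only [iteratedDeriv_const_mul_field, coe_gaussExpSchwartz]
    have ht := norm_sub_sub_le_of_hasDerivAt
      (f := fun z => |t| ^ i.1 * iteratedDeriv i.2 (gaussExp n z) t)
      (C := (2 * Real.pi) ^ 2 * M i) (z := z) (w := w)
      (fun y => (hasDerivAt_iteratedDeriv_gaussExp i.2 t n y).const_mul _)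
      (fun y => ((hasDerivAt_iteratedDeriv_gaussExp i.2 t (n + 1) y).const_mul
        (2 * Real.pi : ℂ)).const_mul _) (fun y hy => by
          have hyR : ‖y‖ ≤ ‖z‖ + 1 := by
            rw [Metric.mem_closedBall, dist_eq_norm] at hy
            linarith [norm_le_norm_add_norm_sub' y z]
          have := hM i y hyR t
          calc _ = (2 * Real.pi) ^ 2 *
                (|t| ^ i.1 * ‖iteratedDeriv i.2 (gaussExp (n + 2) y) t‖) := by
                simp [abs_of_pos Real.pi_pos]; ring
            _ ≤ _ := by gcongr)
    refine le_trans (le_of_eq ?_) ht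
    rw [hqt]
    have habs : |t| ^ i.1 = ‖((|t| : ℝ) : ℂ) ^ i.1‖ := by simp
    rw [habs, ← norm_mul]
    congr 1
    ring
  have hlin : ξ (gaussExpSchwartz n w) - ξ (gaussExpSchwartz n z) -
      (w - z) • ξ ((2 * Real.pi : ℂ) • gaussExpSchwartz (n + 1) z) = ξ q := by
    rw [hq, map_sub, map_sub, map_smul (ξ : 𝓢(ℝ, ℂ) →L[ℂ] ℂ) (w - z)]
  rw [hlin, norm_pow, norm_norm]
  calc ‖ξ q‖ ≤ C * (s.sup (schwartzSeminormFamily ℂ ℝ ℂ)) q := hC q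
    _ ≤ C * ∑ i ∈ s, (2 * Real.pi) ^ 2 * M i * ‖w - z‖ ^ 2 := by
        gcongr
        have h0 : ∀ i ∈ s, 0 ≤ (2 * Real.pi) ^ 2 * M i * ‖w - z‖ ^ 2 := fun i _ => by
          have := hM0 i; positivity
        exact Seminorm.finset_sup_apply_le (Finset.sum_nonneg h0) fun i hi =>
          (hsemi i).trans (Finset.single_le_sum h0 hi)
    _ = _ := by rw [← Finset.sum_mul, mul_assoc]

/-- The Gabor transform of a tempered distribution is, up to the Gaussian factor, the entire
function `z ↦ ξ (gaussExp 0 z)` at `z = u - i v`. -/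
theorem stftDistribution_gaussWindow (ξ : 𝓢'(ℝ, ℂ)) (u v : ℝ) :
    stftDistribution gaussWindow ξ u v =
      ((2 : ℝ) ^ (1 / 4 : ℝ) * Real.exp (-(Real.pi * u ^ 2)) : ℝ) *
        ξ (gaussExpSchwartz 0 (u - v * Complex.I)) := by
  rw [stftDistribution, ← smul_eq_mul, ← map_smul (ξ : 𝓢(ℝ, ℂ) →L[ℂ] ℂ)]
  congr 1
  ext t
  rw [conjSchwartz_apply, timeFreqShiftSchwartz_apply, timeFreqShift, gaussWindow_apply,
    _root_.smul_apply, gaussExpSchwartz_apply, gaussExp, map_mul, Complex.conj_ofReal,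
    ← Complex.exp_conj]
  simp only [map_mul, Complex.conj_ofReal, Complex.conj_I, map_ofNat, Complex.ofReal_mul,
    Complex.ofReal_exp, smul_eq_mul, pow_zero, one_mul]
  rw [mul_left_comm, ← Complex.exp_add, mul_assoc (Complex.ofReal _), ← Complex.exp_add]
  congr 2
  push_cast
  ring

/-- The Gabor transform of a tempered distribution is continuous. -/
theorem continuous_stftDistribution_gaussWindow (ξ : 𝓢'(ℝ, ℂ)) :
    Continuous fun p : ℝ × ℝ => stftDistribution gaussWindow ξ p.1 p.2 := by
  have h : Continuous fun z => ξ (gaussExpSchwartz 0 z) :=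
    continuous_iff_continuousAt.2 fun z => (hasDerivAt_apply_gaussExp ξ 0 z).continuousAt
  simp only [stftDistribution_gaussWindow]
  have h1 : Continuous fun p : ℝ × ℝ => ξ (gaussExpSchwartz 0 (p.1 - p.2 * Complex.I)) :=
    h.comp (by fun_prop : Continuous fun p : ℝ × ℝ => (p.1 - p.2 * Complex.I : ℂ))
  exact Continuous.mul (by fun_prop) h1

/-! ### A sub-mean value inequality -/

/-- Jensen's inequality and the mean value property of holomorphic functions. -/
theorem convexOn_comp_le_circleAverage {G : ℂ → ℂ} (hG : Differentiable ℂ G) {φ : ℂ → ℝ}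
    (hφ : ConvexOn ℝ Set.univ φ) (hφc : Continuous φ) (c : ℂ) (R : ℝ) :
    φ (G c) ≤ Real.circleAverage (fun z => φ (G z)) c R := by
  have hGR : Continuous fun θ => G (circleMap c R θ) :=
    hG.continuous.comp (continuous_circleMap c R)
  rw [← hG.diffContOnCl.circleAverage (R := R), Real.circleAverage_eq_intervalAverage,
    Real.circleAverage_eq_intervalAverage]
  have h0 : volume (Set.uIoc 0 (2 * Real.pi)) ≠ 0 := by
    rw [Set.uIoc_of_le (by positivity)]; simp [Real.pi_pos]
  have h1 : volume (Set.uIoc 0 (2 * Real.pi)) ≠ ⊤ := by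
    rw [Set.uIoc_of_le (by positivity), Real.volume_Ioc]; exact ENNReal.ofReal_ne_top
  exact hφ.map_set_average_le hφc.continuousOn isClosed_univ h0 h1 (by simp)
    (hGR.integrableOn_uIoc) ((hφc.comp hGR).integrableOn_uIoc)

/-- A continuous nonnegative function below its circle averages is below its averages over
discs. -/
theorem ofReal_mul_volume_ball_le {H : ℂ → ℝ} (hH : Continuous H) (h0 : ∀ z, 0 ≤ H z) (c : ℂ)
    (hsub : ∀ R, H c ≤ Real.circleAverage H c R) (r : ℝ) :
    ENNReal.ofReal (H c) * volume (Metric.ball c r) ≤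
      ∫⁻ z in Metric.ball c r, ENNReal.ofReal (H z) := by
  have hsym : ∀ p : ℝ × ℝ, c + Complex.polarCoord.symm p = circleMap c p.1 p.2 := fun p => by
    rw [Complex.polarCoord_symm_apply, circleMap, Complex.exp_mul_I]; simp
  -- both sides are compared on every circle, in polar coordinates around `c`
  have hball : MeasurableSet (Metric.ball c r) := Metric.isOpen_ball.measurableSet
  have polar : ∀ f : ℂ → ENNReal, Measurable f → ∫⁻ z in Metric.ball c r, f z =
      ∫⁻ ρ in Set.Ioi (0 : ℝ), ∫⁻ θ in Set.Ioo (-Real.pi) Real.pi,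
        ENNReal.ofReal ρ * (Metric.ball c r).indicator f (circleMap c ρ θ) := by
    intro f hf
    have hm : Measurable ((Metric.ball c r).indicator f) := hf.indicator hball
    rw [← lintegral_indicator hball, ← lintegral_add_left_eq_self _ c,
      ← Complex.lintegral_comp_polarCoord_symm, polarCoord_target, Measure.volume_eq_prod,
      ← Measure.prod_restrict, lintegral_prod]
    · simp only [hsym, smul_eq_mul]
    · simp only [hsym, smul_eq_mul]
      refine Measurable.aemeasurable ?_
      have : Measurable fun p : ℝ × ℝ => circleMap c p.1 p.2 := by
        unfold circleMap; fun_prop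
      exact (by fun_prop : Measurable fun p : ℝ × ℝ => ENNReal.ofReal p.1).mul (hm.comp this)
  rw [← setLIntegral_const, polar _ measurable_const, polar _ (by fun_prop)]
  refine setLIntegral_mono' measurableSet_Ioi fun ρ hρ => ?_
  have hρ0 : 0 < ρ := hρ
  have hmem : ∀ θ, circleMap c ρ θ ∈ Metric.ball c r ↔ ρ < r := fun θ => by
    simp [Metric.mem_ball, dist_eq_norm, abs_of_pos hρ0]
  by_cases hr : ρ < r
  · simp only [Set.indicator_of_mem ((hmem _).2 hr)]
    rw [lintegral_const_mul _ (by fun_prop), lintegral_const_mul _ (by fun_prop)]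
    refine mul_le_mul_right ?_ _
    rw [setLIntegral_const, Real.volume_Ioo,
      ← ofReal_integral_eq_lintegral_ofReal, ← ENNReal.ofReal_mul (h0 c)]
    · refine ENNReal.ofReal_le_ofReal ?_
      have h := hsub ρ
      have hcirc : Real.circleAverage H c ρ =
          (2 * Real.pi)⁻¹ * ∫ θ in Set.Ioo (-Real.pi) Real.pi, H (circleMap c ρ θ) := by
        rw [Real.circleAverage_eq_integral_add (-Real.pi), smul_eq_mul,
          intervalIntegral.integral_comp_add_right (fun θ => H (circleMap c ρ θ)),
          zero_add, (by ring : 2 * Real.pi + -Real.pi = Real.pi),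
          intervalIntegral.integral_of_le (by linarith [Real.pi_pos]),
          ← integral_Ioc_eq_integral_Ioo]
      rw [hcirc, inv_mul_eq_div, le_div_iff₀ (by positivity)] at h
      linarith
    · exact ((by fun_prop : Continuous fun θ => H (circleMap c ρ θ)).integrableOn_Icc).mono_set
        Set.Ioo_subset_Icc_self
    · exact Filter.Eventually.of_forall fun θ => h0 _
  · simp [Set.indicator_of_notMem (fun h => hr ((hmem _).1 h))]

theorem convexOn_exp_mul_norm_sq {a : ℝ} (ha : 0 ≤ a) :
    ConvexOn ℝ Set.univ fun w : ℂ => Real.exp (a * ‖w‖ ^ 2) := by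
  have h1 : ConvexOn ℝ Set.univ fun w : ℂ => a * ‖w‖ ^ 2 := by
    simpa using (((convexOn_univ_norm (E := ℂ)).pow (fun _ _ => norm_nonneg _) 2).smul ha)
  exact (convexOn_exp.subset (Set.subset_univ _)
    (isPreconnected_univ.image _ (by fun_prop)).ordConnected.convex).comp h1
      (Real.exp_monotone.monotoneOn _)

/-- The Gaussian Gabor transform of a tempered distribution satisfies a sub-mean value inequality:
after multiplication by a nonvanishing holomorphic function it differs from a holomorphic function,
on the disc of radius `1 / 4`, by a factor between `2^{-1/2}` and `1`. -/
theorem exp_stftDistribution_le_lintegral_ball (ξ : 𝓢'(ℝ, ℂ)) {a : ℝ} (ha : 0 ≤ a) (c : ℂ) :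
    ENNReal.ofReal (Real.exp (a * ‖stftDistribution gaussWindow ξ c.re (-c.im)‖ ^ 2)) *
        volume (Metric.ball c (1 / 4)) ≤
      ∫⁻ z in Metric.ball c (1 / 4), ENNReal.ofReal
        (Real.exp (2 * a * ‖stftDistribution gaussWindow ξ z.re (-z.im)‖ ^ 2)) := by
  have hF : Differentiable ℂ fun z => ξ (gaussExpSchwartz 0 z) := fun z =>
    (hasDerivAt_apply_gaussExp ξ 0 z).differentiableAt
  set G : ℂ → ℂ := fun z => ((2 : ℝ) ^ (1 / 4 : ℝ) * Real.exp (-(Real.pi * c.re ^ 2)) : ℝ) *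
    Complex.exp (-(2 * Real.pi * c.re) * (z - c.re)) * ξ (gaussExpSchwartz 0 z) with hGdef
  have hG : Differentiable ℂ G := Differentiable.mul (by fun_prop) hF
  have hGV : ∀ z, ‖G z‖ = Real.exp (Real.pi * (z.re - c.re) ^ 2) *
      ‖stftDistribution gaussWindow ξ z.re (-z.im)‖ := by
    intro z
    have hz : (z.re - (-z.im : ℝ) * Complex.I : ℂ) = z := by
      rw [Complex.ofReal_neg, neg_mul, sub_neg_eq_add, Complex.re_add_im]
    rw [stftDistribution_gaussWindow, hz, hGdef]
    simp only [norm_mul, Complex.norm_real, Complex.norm_exp, Real.norm_eq_abs, ← mul_assoc]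
    congr 1
    have hre : (-(2 * Real.pi * c.re) * (z - c.re) : ℂ).re =
        -(2 * Real.pi * c.re) * (z.re - c.re) := by
      have : (-(2 * Real.pi * c.re) * (z - c.re) : ℂ) =
        ((-(2 * Real.pi * c.re) : ℝ) : ℂ) * (z - c.re) := by push_cast; ring
      rw [this, Complex.re_ofReal_mul]; simp
    have hsq : -(Real.pi * c.re ^ 2) + -(2 * Real.pi * c.re) * (z.re - c.re) =
        Real.pi * (z.re - c.re) ^ 2 + -(Real.pi * z.re ^ 2) := by ring
    simp only [hre, Real.abs_exp]
    rw [mul_assoc, ← Real.exp_add, hsq, Real.exp_add]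
    ring
  have h := ofReal_mul_volume_ball_le (H := fun z => Real.exp (a * ‖G z‖ ^ 2))
    (by have := hG.continuous; fun_prop) (fun z => (Real.exp_pos _).le) c
    (fun R => convexOn_comp_le_circleAverage hG (convexOn_exp_mul_norm_sq ha) (by fun_prop) c R)
    (1 / 4)
  have hc : ‖G c‖ = ‖stftDistribution gaussWindow ξ c.re (-c.im)‖ := by simp [hGV]
  rw [hc] at h
  refine h.trans (setLIntegral_mono' Metric.isOpen_ball.measurableSet fun z hz => ?_)
  refine ENNReal.ofReal_le_ofReal (Real.exp_le_exp.2 ?_)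
  rw [hGV, mul_pow, ← Real.exp_nat_mul]
  have hre : (z.re - c.re) ^ 2 ≤ (1 / 4) ^ 2 := by
    rw [Metric.mem_ball, dist_eq_norm] at hz
    have := (Complex.abs_re_le_norm (z - c)).trans hz.le
    rw [Complex.sub_re] at this
    exact sq_le_sq' (by linarith [neg_abs_le (z.re - c.re)]) ((le_abs_self _).trans this)
  -- `2 π / 16 < 1 / 2 < log 2`
  have h2 : Real.exp ((2 : ℕ) * (Real.pi * (z.re - c.re) ^ 2)) ≤ 2 := by
    rw [← Real.le_log_iff_exp_le two_pos]
    have := Real.log_two_gt_d9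
    have := Real.pi_lt_four
    push_cast
    nlinarith [Real.pi_pos]
  nlinarith [mul_le_mul_of_nonneg_right h2
    (mul_nonneg ha (sq_nonneg ‖stftDistribution gaussWindow ξ z.re (-z.im)‖))]

/-! ### White noise: Gaussian marginals and the supremum over a box -/

theorem measurable_temperedDistribution_apply (φ : 𝓢(ℝ, ℂ)) :
    Measurable fun ξ : 𝓢'(ℝ, ℂ) => ξ φ :=
  (PointwiseConvergenceCLM.evalCLM (RingHom.id ℂ) ℂ φ).continuous.measurable

section

variable {Ω : Type*} [MeasurableSpace Ω] {P : Measure Ω} {ξ : Ω → 𝓢'(ℝ, ℂ)}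

theorem IsWhiteNoise.ae_im_eq_zero (h : IsWhiteNoise P ξ) :
    ∀ᵐ ω ∂P, ∀ φ : 𝓢(ℝ, ℝ), (ξ ω (toComplex φ)).im = 0 :=
  ae_of_ae_map h.measurable.aemeasurable h.law.real

/-- White noise tested against a real Schwartz function is a centred Gaussian whose variance is
the squared `L²` norm. -/
theorem IsWhiteNoise.map_eq_gaussianReal [IsProbabilityMeasure P] (h : IsWhiteNoise P ξ)
    (φ : 𝓢(ℝ, ℝ)) :
    P.map (fun ω => (ξ ω (toComplex φ)).re) =
      ProbabilityTheory.gaussianReal 0 (∫ t, φ t ^ 2).toNNReal := by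
  have hX : Measurable fun ω => (ξ ω (toComplex φ)).re :=
    Complex.measurable_re.comp ((measurable_temperedDistribution_apply _).comp h.measurable)
  have : IsProbabilityMeasure (P.map fun ω => (ξ ω (toComplex φ)).re) :=
    Measure.isProbabilityMeasure_map hX.aemeasurable
  refine Measure.ext_of_charFun (funext fun s => ?_)
  rw [ProbabilityTheory.charFun_gaussianReal, charFun_apply_real,
    integral_map hX.aemeasurable (by fun_prop)]
  have hc := h.law.charFun (s • φ)
  rw [integral_map h.measurable.aemeasurable
    (by
      have := measurable_temperedDistribution_apply (toComplex (s • φ))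
      exact (Complex.measurable_exp.comp (this.const_mul _)).aestronglyMeasurable)] at hc
  have hs : toComplex (s • φ) = (s : ℂ) • toComplex φ := by
    ext t; simp [toComplex_apply]
  refine (integral_congr_ae ?_).trans (hc.trans ?_)
  · filter_upwards [h.ae_im_eq_zero] with ω hω
    rw [hs, map_smul (ξ ω : 𝓢(ℝ, ℂ) →L[ℂ] ℂ), smul_eq_mul]
    have : ξ ω (toComplex φ) = ((ξ ω (toComplex φ)).re : ℂ) :=
      Complex.ext rfl (by simp [hω φ])
    rw [this]
    simp only [Complex.ofReal_re]
    ring_nf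
  · have hn : 0 ≤ ∫ t, φ t ^ 2 := integral_nonneg fun t => sq_nonneg _
    have he : ∫ t, (s • φ) t ^ 2 = s ^ 2 * ∫ t, φ t ^ 2 := by
      rw [← integral_const_mul]
      exact integral_congr_ae (Filter.Eventually.of_forall fun t => by simp [mul_pow])
    have hv : (((∫ t, φ t ^ 2).toNNReal : ℝ) : ℂ) = ((∫ t, φ t ^ 2 : ℝ) : ℂ) := by
      rw [Real.coe_toNNReal _ hn]
    rw [he]
    congr 1
    rw [hv]
    push_cast
    ring

/-- Exponential square integrability of a Gaussian of variance at most one. -/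
theorem lintegral_exp_mul_sq_gaussianReal_le {v : NNReal} (hv : v ≤ 1) {b : ℝ} (hb0 : 0 ≤ b)
    (hb : b ≤ 3 / 8) :
    ∫⁻ x, ENNReal.ofReal (Real.exp (b * x ^ 2)) ∂ProbabilityTheory.gaussianReal 0 v ≤ 2 := by
  have hmap : ProbabilityTheory.gaussianReal 0 v =
      (ProbabilityTheory.gaussianReal 0 1).map (fun x => √(v : ℝ) * x) := by
    rw [ProbabilityTheory.gaussianReal_map_const_mul]
    congr 1
    · simp
    · ext; simp
  rw [hmap, lintegral_map (by fun_prop) (by fun_prop)]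
  calc ∫⁻ x, ENNReal.ofReal (Real.exp (b * (√(v : ℝ) * x) ^ 2))
        ∂ProbabilityTheory.gaussianReal 0 1
      ≤ ∫⁻ x, ENNReal.ofReal (Real.exp (b * x ^ 2)) ∂ProbabilityTheory.gaussianReal 0 1 := by
        refine lintegral_mono fun x => ENNReal.ofReal_le_ofReal (Real.exp_le_exp.2 ?_)
        rw [mul_pow, Real.sq_sqrt v.coe_nonneg]
        have : (v : ℝ) ≤ 1 := by exact_mod_cast hv
        gcongr
        nlinarith [sq_nonneg x]
    _ = ∫⁻ x, ENNReal.ofReal ((√(2 * Real.pi))⁻¹ * Real.exp (-(1 / 2 - b) * x ^ 2)) := by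
        rw [ProbabilityTheory.gaussianReal_of_var_ne_zero 0 one_ne_zero,
          lintegral_withDensity_eq_lintegral_mul _
            (ProbabilityTheory.measurable_gaussianPDF 0 1) (by fun_prop)]
        refine lintegral_congr fun x => ?_
        rw [Pi.mul_apply, ProbabilityTheory.gaussianPDF_def,
          ← ENNReal.ofReal_mul (ProbabilityTheory.gaussianPDFReal_nonneg _ _ _),
          ProbabilityTheory.gaussianPDFReal_def]
        congr 1
        simp only [NNReal.coe_one, mul_one, sub_zero]
        rw [mul_assoc, ← Real.exp_add]
        ring_nf
    _ = ENNReal.ofReal ((√(2 * Real.pi))⁻¹ * √(Real.pi / (1 / 2 - b))) := by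
        rw [← ofReal_integral_eq_lintegral_ofReal, integral_const_mul, integral_gaussian]
        · exact (integrable_exp_neg_mul_sq (by linarith)).const_mul _
        · exact Filter.Eventually.of_forall fun x => by positivity
    _ ≤ 2 := by
        rw [← ENNReal.ofReal_ofNat]
        refine ENNReal.ofReal_le_ofReal ?_
        rw [inv_mul_eq_div, div_le_iff₀ (by positivity)]
        refine Real.sqrt_le_iff.2 ⟨by positivity, ?_⟩
        rw [mul_pow, Real.sq_sqrt (by positivity), div_le_iff₀ (by linarith)]
        nlinarith [Real.pi_pos]

theorem integral_gaussWindow_sq (u : ℝ) : ∫ t, ‖gaussWindow (t - u)‖ ^ 2 = 1 := by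
  have h : ∀ t, ‖gaussWindow t‖ ^ 2 = √2 * Real.exp (-(2 * Real.pi) * t ^ 2) := fun t => by
    rw [gaussWindow_apply, Complex.norm_real, Real.norm_of_nonneg (by positivity), mul_pow,
      ← Real.rpow_natCast, ← Real.rpow_mul two_pos.le, ← Real.exp_nat_mul, Real.sqrt_eq_rpow]
    norm_num
    ring_nf
  rw [integral_sub_right_eq_self (fun t => ‖gaussWindow t‖ ^ 2)]
  simp only [h]
  rw [integral_const_mul, integral_gaussian, ← Real.sqrt_mul two_pos.le]
  rw [mul_comm 2 Real.pi, ← div_div, div_self Real.pi_pos.ne']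
  norm_num

theorem integrable_gaussWindow_sq (u : ℝ) : Integrable fun t => ‖gaussWindow (t - u)‖ ^ 2 :=
  (not_imp_comm.1 integral_undef) (by rw [integral_gaussWindow_sq]; exact one_ne_zero)

/-- Real and imaginary part of the Gabor transform of white noise at a point are Gaussian with
variance at most one, because the window is normalized. Their independence is not needed: the
exponential of the sum of squares is split by the arithmetic-geometric mean inequality, at the
price of doubling `b`. -/
theorem IsWhiteNoise.lintegral_exp_stft_le [IsProbabilityMeasure P] (h : IsWhiteNoise P ξ)
    {b : ℝ} (hb0 : 0 ≤ b) (hb : b ≤ 3 / 16) (u v : ℝ) :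
    ∫⁻ ω, ENNReal.ofReal (Real.exp (b * ‖stftDistribution gaussWindow (ξ ω) u v‖ ^ 2)) ∂P ≤ 2 := by
  set ψ : 𝓢(ℝ, ℂ) := conjSchwartz (timeFreqShiftSchwartz u v gaussWindow) with hψ
  have hψn : ∀ t, ‖ψ t‖ = ‖gaussWindow (t - u)‖ := fun t => by
    have : (2 * Real.pi * Complex.I * v * t : ℂ) =
      ((2 * Real.pi * v * t : ℝ) : ℂ) * Complex.I := by push_cast; ring
    rw [hψ, conjSchwartz_apply, timeFreqShiftSchwartz_apply, timeFreqShift, RCLike.norm_conj,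
      norm_mul, this, Complex.norm_exp_ofReal_mul_I, one_mul]
  let α : 𝓢(ℝ, ℝ) := SchwartzMap.postcompCLM Complex.reCLM ψ
  let β : 𝓢(ℝ, ℝ) := SchwartzMap.postcompCLM Complex.imCLM ψ
  have hα : ∀ t, α t = (ψ t).re := fun t => rfl
  have hβ : ∀ t, β t = (ψ t).im := fun t => rfl
  have hdec : ψ = toComplex α + Complex.I • toComplex β := by
    ext t
    rw [_root_.add_apply, _root_.smul_apply, toComplex_apply, toComplex_apply, hα, hβ,
      smul_eq_mul, mul_comm, Complex.re_add_im]
  have hvar : ∀ f : 𝓢(ℝ, ℝ), (∀ t, |f t| ≤ ‖ψ t‖) →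
      ∫⁻ ω, ENNReal.ofReal (Real.exp (2 * b * (ξ ω (toComplex f)).re ^ 2)) ∂P ≤ 2 := by
    intro f hf
    have hint : ∫ t, f t ^ 2 ≤ 1 := by
      rw [← integral_gaussWindow_sq u]
      refine integral_mono_of_nonneg (Filter.Eventually.of_forall fun t => sq_nonneg _)
        (integrable_gaussWindow_sq u) (Filter.Eventually.of_forall fun t => ?_)
      simp only [← hψn, ← sq_abs (f t)]
      gcongr
      exact hf t
    have hX : Measurable fun ω => (ξ ω (toComplex f)).re :=
      Complex.measurable_re.comp ((measurable_temperedDistribution_apply _).comp h.measurable)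
    rw [← lintegral_map (f := fun x : ℝ => ENNReal.ofReal (Real.exp (2 * b * x ^ 2)))
      (by fun_prop) hX, h.map_eq_gaussianReal f]
    exact lintegral_exp_mul_sq_gaussianReal_le (by simpa using hint) (by linarith) (by linarith)
  have h1 := hvar α fun t => Complex.abs_re_le_norm _
  have h2 := hvar β fun t => Complex.abs_im_le_norm _
  have hmeas : Measurable fun ω => (ξ ω (toComplex α)).re :=
    Complex.measurable_re.comp ((measurable_temperedDistribution_apply _).comp h.measurable)
  calc _ ≤ ∫⁻ ω, ENNReal.ofReal (1 / 2) *
        (ENNReal.ofReal (Real.exp (2 * b * (ξ ω (toComplex α)).re ^ 2)) +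
          ENNReal.ofReal (Real.exp (2 * b * (ξ ω (toComplex β)).re ^ 2))) ∂P := by
        refine lintegral_mono_ae ?_
        filter_upwards [h.ae_im_eq_zero] with ω hω
        rw [← ENNReal.ofReal_add (Real.exp_pos _).le (Real.exp_pos _).le,
          ← ENNReal.ofReal_mul (by norm_num)]
        refine ENNReal.ofReal_le_ofReal ?_
        have hn : ‖stftDistribution gaussWindow (ξ ω) u v‖ ^ 2 =
            (ξ ω (toComplex α)).re ^ 2 + (ξ ω (toComplex β)).re ^ 2 := by
          rw [stftDistribution, ← hψ, hdec, map_add (ξ ω : 𝓢(ℝ, ℂ) →L[ℂ] ℂ),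
            map_smul (ξ ω : 𝓢(ℝ, ℂ) →L[ℂ] ℂ), Complex.sq_norm, Complex.normSq_apply]
          simp [hω α, hω β]
          ring
        rw [hn]
        have e : ∀ x : ℝ, Real.exp (2 * b * x ^ 2) = Real.exp (b * x ^ 2) ^ 2 := fun x => by
          rw [← Real.exp_nat_mul]; push_cast; ring_nf
        rw [mul_add, Real.exp_add, e, e]
        nlinarith [sq_nonneg (Real.exp (b * (ξ ω (toComplex α)).re ^ 2) -
          Real.exp (b * (ξ ω (toComplex β)).re ^ 2))]
    _ ≤ ENNReal.ofReal (1 / 2) * (2 + 2) := by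
        rw [lintegral_const_mul' _ _ ENNReal.ofReal_ne_top, lintegral_add_left (by fun_prop)]
        gcongr
    _ = 2 := by
        rw [← ENNReal.ofReal_ofNat, ← ENNReal.ofReal_add (by norm_num) (by norm_num),
          ← ENNReal.ofReal_mul (by norm_num)]
        norm_num

theorem IsWhiteNoise.measurable_stft (h : IsWhiteNoise P ξ) (u v : ℝ) :
    Measurable fun ω => stftDistribution gaussWindow (ξ ω) u v :=
  (measurable_temperedDistribution_apply _).comp h.measurable

theorem IsWhiteNoise.measurable_stft_prod (h : IsWhiteNoise P ξ) :
    Measurable fun p : Ω × ℂ => stftDistribution gaussWindow (ξ p.1) p.2.re (-p.2.im) := by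
  have hc : ∀ ω, Continuous fun z : ℂ => stftDistribution gaussWindow (ξ ω) z.re (-z.im) :=
    fun ω => Continuous.comp
      (g := fun p : ℝ × ℝ => stftDistribution gaussWindow (ξ ω) p.1 p.2)
      (f := fun z : ℂ => (z.re, -z.im)) (continuous_stftDistribution_gaussWindow (ξ ω))
      (by fun_prop)
  have h1 := measurable_uncurry_of_continuous_of_measurable
    (u := fun (z : ℂ) (ω : Ω) => stftDistribution gaussWindow (ξ ω) z.re (-z.im)) hc
    (fun z => h.measurable_stft z.re (-z.im))
  exact Measurable.comp h1 (f := fun p : Ω × ℂ => (p.2, p.1)) (by fun_prop)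

/-- The tail of the supremum of the Gabor transform of white noise over a box. The sub-mean value
inequality replaces chaining: the supremum of `exp (|V_g ξ|² / 4π)` is at most a multiple of the
integral of `exp (|V_g ξ|² / 2π)` over a slightly larger region, and that has finite expectation. -/
theorem IsWhiteNoise.measure_exists_box_le [IsProbabilityMeasure P] (h : IsWhiteNoise P ξ)
    {L s : ℝ} (hL : 1 ≤ L) (hs : 0 ≤ s) :
    P {ω | ∃ z ∈ box L, s < ‖stftDistribution gaussWindow (ξ ω) z.re z.im‖} ≤
      ENNReal.ofReal (128 * L ^ 2 * Real.exp (-(s ^ 2 / (4 * Real.pi)))) := by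
  have hπ := Real.pi_pos
  set a : ℝ := 1 / (4 * Real.pi) with ha
  have ha0 : 0 ≤ a := by positivity
  set B : Set ℂ := Metric.closedBall 0 (2 * L) with hB
  set f : Ω → ℂ → ENNReal := fun ω z => ENNReal.ofReal
    (Real.exp (2 * a * ‖stftDistribution gaussWindow (ξ ω) z.re (-z.im)‖ ^ 2)) with hf
  have hfm : Measurable (Function.uncurry f) := by
    have h2 := h.measurable_stft_prod
    exact (Real.measurable_exp.comp ((h2.norm.pow_const 2).const_mul (2 * a))).ennreal_ofReal
  have hE : ∫⁻ ω, (∫⁻ z in B, f ω z) ∂P ≤ ENNReal.ofReal (8 * Real.pi * L ^ 2) := by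
    rw [lintegral_lintegral_swap hfm.aemeasurable]
    have hb : 2 * a ≤ 3 / 16 := by
      rw [ha, ← div_eq_mul_one_div, div_le_iff₀ (by positivity)]
      linarith [Real.pi_gt_three]
    calc _ ≤ ∫⁻ _ in B, 2 := lintegral_mono fun z => h.lintegral_exp_stft_le (by positivity) hb _ _
      _ = _ := by
        rw [setLIntegral_const, hB, Complex.volume_closedBall, ← ENNReal.ofReal_ofNat 2,
          ← ENNReal.ofReal_pow (by positivity), ← ENNReal.ofReal_coe_nnreal,
          ← ENNReal.ofReal_mul (by positivity), ← ENNReal.ofReal_mul (by positivity)]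
        congr 1
        simp
        ring
  set ε : ENNReal := ENNReal.ofReal (Real.exp (a * s ^ 2)) * volume (Metric.ball (0 : ℂ) (1 / 4))
    with hε
  have hεr : ε = ENNReal.ofReal (Real.exp (a * s ^ 2) * (Real.pi / 16)) := by
    rw [hε, Complex.volume_ball, ← ENNReal.ofReal_pow (by positivity),
      ← ENNReal.ofReal_coe_nnreal, ← ENNReal.ofReal_mul (by positivity),
      ← ENNReal.ofReal_mul (by positivity)]
    congr 1
    simp
    ring
  have hsub : {ω | ∃ z ∈ box L, s < ‖stftDistribution gaussWindow (ξ ω) z.re z.im‖} ⊆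
      {ω | ε ≤ ∫⁻ z in B, f ω z} := by
    rintro ω ⟨z, hz, hsz⟩
    -- the entire function lives on the conjugate plane, and the box is symmetric
    set w : ℂ := ⟨z.re, -z.im⟩ with hw
    have hz : max |z.re| |z.im| ≤ L := hz
    have hwn : ‖w‖ ≤ 3 / 2 * L := by
      refine abs_le_of_sq_le_sq' (a := ‖w‖) ?_ (by linarith) |>.2
      rw [Complex.sq_norm, Complex.normSq_apply]
      have h1 := sq_le_sq' (by linarith [neg_abs_le z.re, (le_max_left _ _).trans hz])
        ((le_abs_self _).trans ((le_max_left _ _).trans hz))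
      have h2 := sq_le_sq' (by linarith [neg_abs_le z.im, (le_max_right _ _).trans hz])
        ((le_abs_self _).trans ((le_max_right _ _).trans hz))
      simp only [hw]
      nlinarith
    have hball : Metric.ball w (1 / 4) ⊆ B := fun y hy => by
      rw [hB, Metric.mem_closedBall, dist_zero_right]
      rw [Metric.mem_ball, dist_eq_norm] at hy
      linarith [norm_le_norm_add_norm_sub' y w]
    calc ε ≤ ENNReal.ofReal
            (Real.exp (a * ‖stftDistribution gaussWindow (ξ ω) w.re (-w.im)‖ ^ 2)) *
          volume (Metric.ball w (1 / 4)) := by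
          have hV : volume (Metric.ball (0 : ℂ) (1 / 4)) = volume (Metric.ball w (1 / 4)) := by
            rw [Complex.volume_ball, Complex.volume_ball]
          rw [hε, hV]
          gcongr
          simpa [hw] using hsz.le
      _ ≤ ∫⁻ z in Metric.ball w (1 / 4), f ω z :=
          exp_stftDistribution_le_lintegral_ball (ξ ω) ha0 w
      _ ≤ _ := lintegral_mono_set hball
  have hε0 : ε ≠ 0 := by
    rw [hεr]; exact (ENNReal.ofReal_pos.2 (by positivity)).ne'
  have hεt : ε ≠ ⊤ := by rw [hεr]; exact ENNReal.ofReal_ne_top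
  refine (measure_mono hsub).trans ((meas_ge_le_lintegral_div
    (hfm.lintegral_prod_right' (ν := volume.restrict B)).aemeasurable hε0 hεt).trans ?_)
  refine (ENNReal.div_le_div_right hE ε).trans (le_of_eq ?_)
  rw [hεr, ← ENNReal.ofReal_div_of_pos (by positivity)]
  congr 1
  have : Real.exp (-(s ^ 2 / (4 * Real.pi))) = (Real.exp (a * s ^ 2))⁻¹ := by
    rw [← Real.exp_neg, ha]; ring_nf
  rw [this]
  field_simp
  ring

/-! ### Measurability of events about continuous random fields -/

section Measurability

variable {X : Type*} [PseudoMetricSpace X] [TopologicalSpace.SeparableSpace X] {A : Set X}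
  {f : Ω → X → ℝ}

theorem measurableSet_forall_mem_le (hm : ∀ x, Measurable fun ω => f ω x)
    (hc : ∀ ω, Continuous (f ω)) (c : ℝ) : MeasurableSet {ω | ∀ x ∈ A, f ω x ≤ c} := by
  obtain ⟨D, hDA, hDc, hD⟩ :=
    (TopologicalSpace.IsSeparable.of_separableSpace A).exists_countable_dense_subset
  have : {ω | ∀ x ∈ A, f ω x ≤ c} = ⋂ d ∈ D, {ω | f ω d ≤ c} := by
    ext ω
    simp only [Set.mem_iInter, Set.mem_ofPred_eq]
    exact ⟨fun h d hd => h d (hDA hd), fun h x hx =>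
      closure_minimal h (isClosed_le (hc ω) continuous_const) (hD hx)⟩
  rw [this]
  exact MeasurableSet.biInter hDc fun d _ => measurableSet_le (hm d) measurable_const

theorem measurableSet_exists_mem_le (hA : IsCompact A) (hm : ∀ x, Measurable fun ω => f ω x)
    (hc : ∀ ω, Continuous (f ω)) (c : ℝ) : MeasurableSet {ω | ∃ x ∈ A, c ≤ f ω x} := by
  have : {ω | ∃ x ∈ A, c ≤ f ω x} = ⋂ n : ℕ, {ω | ∀ x ∈ A, f ω x ≤ c - 1 / (n + 1)}ᶜ := by
    ext ω
    simp only [Set.mem_iInter, Set.mem_compl_iff, Set.mem_ofPred_eq]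
    constructor
    · rintro ⟨x, hx, hcx⟩ n h
      have := h x hx
      have : (0 : ℝ) < 1 / (n + 1) := by positivity
      linarith
    · intro h
      push Not at h
      obtain ⟨y, hy, -⟩ := h 0
      obtain ⟨x, hx, hmax⟩ := hA.exists_isMaxOn ⟨y, hy⟩ (hc ω).continuousOn
      refine ⟨x, hx, le_of_forall_pos_lt_add fun ε hε => ?_⟩
      obtain ⟨n, hn⟩ := exists_nat_one_div_lt hε
      obtain ⟨z, hz, hzn⟩ := h n
      have : f ω z ≤ f ω x := hmax hz
      linarith
  rw [this]
  exact MeasurableSet.iInter fun n => (measurableSet_forall_mem_le hm hc _).compl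

end Measurability

end

/-! ### The Gabor transform of Hermite functions -/

theorem exp_mul_poly_gauss_eq (u t : ℝ) (p : Polynomial ℝ) :
    Real.exp (2 * Real.pi * u * t) * (p.eval t * Real.exp (-(2 * Real.pi * t ^ 2))) =
      Real.exp (Real.pi * u ^ 2 / 2) * polyGauss (2 * Real.pi) (by positivity)
        (p.comp (Polynomial.X + Polynomial.C (u / 2))) (t - u / 2) := by
  rw [polyGauss_apply, Polynomial.eval_comp]
  simp only [Polynomial.eval_add, Polynomial.eval_X, Polynomial.eval_C, sub_add_cancel]
  rw [mul_left_comm, mul_left_comm (Real.exp (Real.pi * u ^ 2 / 2)), ← Real.exp_add,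
    ← Real.exp_add]
  ring_nf

theorem integrable_exp_mul_poly_gauss (u : ℝ) (p : Polynomial ℝ) :
    Integrable fun t : ℝ =>
      Real.exp (2 * Real.pi * u * t) * (p.eval t * Real.exp (-(2 * Real.pi * t ^ 2))) := by
  simp only [exp_mul_poly_gauss_eq]
  exact ((SchwartzMap.integrable _).comp_sub_right (u / 2)).const_mul _

/-- `k` integrations by parts. -/
theorem integral_exp_mul_iteratedDeriv_gauss (u : ℝ) (k : ℕ) :
    ∫ t : ℝ, Real.exp (2 * Real.pi * u * t) *
      iteratedDeriv k (fun t : ℝ => Real.exp (-(2 * Real.pi * t ^ 2))) t =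
    (-(2 * Real.pi * u)) ^ k * (Real.exp (Real.pi * u ^ 2 / 2) / √2) := by
  induction k with
  | zero =>
    have h : ∀ t : ℝ, Real.exp (2 * Real.pi * u * t) * Real.exp (-(2 * Real.pi * t ^ 2)) =
        Real.exp (Real.pi * u ^ 2 / 2) * Real.exp (-(2 * Real.pi) * (t - u / 2) ^ 2) := fun t => by
      rw [← Real.exp_add, ← Real.exp_add]; ring_nf
    simp only [iteratedDeriv_zero, pow_zero, one_mul, h]
    rw [integral_const_mul,
      integral_sub_right_eq_self (fun t => Real.exp (-(2 * Real.pi) * t ^ 2)), integral_gaussian,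
      mul_comm 2 Real.pi, ← div_div, div_self Real.pi_pos.ne', Real.sqrt_div zero_le_one,
      Real.sqrt_one, ← div_eq_mul_one_div]
  | succ k ih =>
    obtain ⟨q, hq⟩ := exists_iteratedDeriv_poly_gauss (2 * Real.pi) 1 k
    simp only [Polynomial.eval_one, one_mul] at hq
    have hE : ∀ t : ℝ, HasDerivAt (fun t => Real.exp (2 * Real.pi * u * t))
        (2 * Real.pi * u * Real.exp (2 * Real.pi * u * t)) t := fun t => by
      have := ((hasDerivAt_id t).const_mul (2 * Real.pi * u)).exp
      simpa [mul_comm] using this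
    have hq' := hasDerivAt_poly_gauss (2 * Real.pi) q
    have hd : deriv (fun t : ℝ => q.eval t * Real.exp (-(2 * Real.pi * t ^ 2))) = _ :=
      funext fun t => (hq' t).deriv
    have hI := integrable_exp_mul_poly_gauss u q
    have hparts := integral_mul_deriv_eq_deriv_mul_of_integrable (fun t _ => hE t)
      (fun t _ => hq' t) (integrable_exp_mul_poly_gauss u _)
      ((hI.const_mul (2 * Real.pi * u)).congr (Filter.Eventually.of_forall fun t => by
        simp only [Pi.mul_apply]; ring)) hI
    rw [iteratedDeriv_succ, hq, hd, hparts, pow_succ', mul_assoc (-(2 * Real.pi * u)), ← ih, hq,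
      ← integral_const_mul, ← integral_neg]
    exact integral_congr_ae (Filter.Eventually.of_forall fun t => by simp only; ring)

theorem peak_pos (k : ℕ) : 0 < peak k :=
  Finset.prod_pos fun t ht => by
    obtain ⟨h1, h2⟩ := Finset.mem_Icc.1 ht
    have h1 : (0 : ℝ) < t := by exact_mod_cast h1
    have h2 : (0 : ℝ) < k := lt_of_lt_of_le h1 (by exact_mod_cast h2)
    positivity

theorem prod_Icc_id_eq_factorial (k : ℕ) : ∏ t ∈ Finset.Icc 1 k, t = k.factorial := by
  induction k with
  | zero => simp
  | succ k ih => rw [Finset.prod_Icc_succ_top (by omega), ih, Nat.factorial_succ, mul_comm]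

theorem peak_sq (k : ℕ) : peak k ^ 2 = k ^ k * Real.exp (-k) / k.factorial := by
  have h : ∀ t : ℕ, √((k : ℝ) / (Real.exp 1 * t)) ^ 2 = k / (Real.exp 1 * t) := fun t =>
    Real.sq_sqrt (by positivity)
  rw [peak, ← Finset.prod_pow, Finset.prod_congr rfl fun t _ => h t, Finset.prod_div_distrib,
    Finset.prod_mul_distrib, Finset.prod_const, Finset.prod_const, Nat.card_Icc,
    add_tsub_cancel_right, ← Nat.cast_prod, prod_Icc_id_eq_factorial, Real.exp_neg,
    ← Real.exp_nat_mul, mul_one]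
  field_simp

theorem stftDistribution_hermiteDistribution (k : ℕ) (u v : ℝ) :
    stftDistribution gaussWindow (hermiteDistribution k) u v =
      stft gaussWindow (fun t => (hermiteFun k t : ℂ)) u v := by
  rw [hermiteDistribution, stftDistribution_coe,
    show ⇑(hermiteSchwartz k) = fun t => (hermiteFun k t : ℂ) from
      funext (hermiteSchwartz_apply k)]

/-- The squared modulus of the transform of `h_k` on the real axis, where it is a real integral.
The level set only needs a lower bound for `|V_g h_k|` at one point, so this ray suffices. -/
theorem norm_sq_stft_hermiteFun (k : ℕ) (u : ℝ) :
    ‖stft gaussWindow (fun t => (hermiteFun k t : ℂ)) u 0‖ ^ 2 =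
      (Real.pi * u ^ 2) ^ k * Real.exp (-(Real.pi * u ^ 2)) / k.factorial := by
  set c : ℝ := Real.sqrt ((2 : ℝ) ^ (2 * (k : ℝ) - 1 / 2) * Real.pi ^ k * k.factorial) with hc
  have hint : stft gaussWindow (fun t => (hermiteFun k t : ℂ)) u 0 =
      (((-1) ^ k / c * (2 : ℝ) ^ (1 / 4 : ℝ) * Real.exp (-(Real.pi * u ^ 2)) *
        ((-(2 * Real.pi * u)) ^ k * (Real.exp (Real.pi * u ^ 2 / 2) / √2)) : ℝ) : ℂ) := by
    rw [← integral_exp_mul_iteratedDeriv_gauss, ← integral_const_mul, ← integral_complex_ofReal,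
      stft]
    refine integral_congr_ae (Filter.Eventually.of_forall fun t => ?_)
    simp only [timeFreqShift, Complex.ofReal_zero, mul_zero, zero_mul, Complex.exp_zero, one_mul,
      gaussWindow_apply, Complex.conj_ofReal, hermiteFun, ← hc, ← Complex.ofReal_mul]
    congr 1
    have e : Real.exp (Real.pi * t ^ 2) * Real.exp (-(Real.pi * (t - u) ^ 2)) =
        Real.exp (-(Real.pi * u ^ 2)) * Real.exp (2 * Real.pi * u * t) := by
      rw [← Real.exp_add, ← Real.exp_add]; ring_nf
    linear_combination ((-1) ^ k / c * (2 : ℝ) ^ (1 / 4 : ℝ) *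
      iteratedDeriv k (fun t : ℝ => Real.exp (-(2 * Real.pi * t ^ 2))) t) * e
  have hc2 : c ^ 2 = (2 : ℝ) ^ (2 * (k : ℝ) - 1 / 2) * Real.pi ^ k * k.factorial :=
    Real.sq_sqrt (by positivity)
  have hrp : (2 : ℝ) ^ (2 * (k : ℝ) - 1 / 2) = 4 ^ k / √2 := by
    rw [Real.rpow_sub two_pos, Real.rpow_mul two_pos.le, Real.sqrt_eq_rpow, Real.rpow_natCast]
    norm_num
  have h4 : ((2 : ℝ) ^ (1 / 4 : ℝ)) ^ 2 = √2 := by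
    rw [← Real.rpow_natCast, ← Real.rpow_mul two_pos.le, Real.sqrt_eq_rpow]; norm_num
  have h2 : √2 ^ 2 = (2 : ℝ) := Real.sq_sqrt two_pos.le
  have he : Real.exp (-(Real.pi * u ^ 2)) ^ 2 * Real.exp (Real.pi * u ^ 2 / 2) ^ 2 =
      Real.exp (-(Real.pi * u ^ 2)) := by
    rw [← Real.exp_nat_mul, ← Real.exp_nat_mul, ← Real.exp_add]
    push_cast
    ring_nf
  have hpow : ((-(2 * Real.pi * u)) ^ k) ^ 2 = 4 ^ k * Real.pi ^ k * (Real.pi * u ^ 2) ^ k := by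
    rw [← pow_mul, mul_comm k 2, pow_mul, ← mul_pow, ← mul_pow]; ring_nf
  have hone : ((-1 : ℝ) ^ k) ^ 2 = 1 := by rw [← pow_mul, mul_comm, pow_mul]; simp
  rw [hint, Complex.norm_real, Real.norm_eq_abs, sq_abs]
  simp only [mul_pow, div_pow]
  rw [← mul_pow, hpow, hone, h4, h2, hc2, hrp]
  have h2' := Real.sqrt_pos.2 (two_pos (α := ℝ))
  calc _ = (√2 * √2) / 2 * (Real.exp (-(Real.pi * u ^ 2)) ^ 2 *
        Real.exp (Real.pi * u ^ 2 / 2) ^ 2) * (Real.pi * u ^ 2) ^ k / k.factorial := by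
        field_simp
    _ = _ := by rw [he, ← sq, h2]; ring

theorem norm_stft_hermiteFun_eq_peak (k : ℕ) :
    ‖stft gaussWindow (fun t => (hermiteFun k t : ℂ)) (√(k / Real.pi)) 0‖ = peak k := by
  refine (pow_left_inj₀ (norm_nonneg _) (peak_pos k).le two_ne_zero).1 ?_
  rw [norm_sq_stft_hermiteFun, peak_sq, Real.sq_sqrt (by positivity),
    mul_div_cancel₀ _ Real.pi_pos.ne']

/-! ### The probability bound and the level sets -/

/-- The constant `14` (that is `K = 1`) in the threshold absorbs the polynomial factor `L ^ 2`. -/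
theorem box_tail_le {L τ : ℝ} (hL : Real.pi ≤ L) (hτ : 0 < τ) :
    128 * L ^ 2 * Real.exp (-((√2 * (14 * 1 + τ) * √(Real.log L)) ^ 2 / (4 * Real.pi))) ≤
      4 * Real.exp (-(τ ^ 2 / (2 * Real.pi) * Real.log L)) := by
  have hπ := Real.pi_pos
  have hL0 : 0 < L := hπ.trans_le hL
  have hl : 1 ≤ Real.log L := by
    rw [Real.le_log_iff_exp_le hL0]
    linarith [Real.exp_one_lt_d9, Real.pi_gt_three]
  have h32 : (32 : ℝ) ≤ Real.exp (5 * Real.log L) := by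
    have h1 : (2 : ℝ) ≤ Real.exp 1 := by linarith [Real.exp_one_gt_d9]
    calc (32 : ℝ) = 2 ^ 5 := by norm_num
      _ ≤ Real.exp 1 ^ 5 := by gcongr
      _ = Real.exp 5 := by rw [← Real.exp_nat_mul]; norm_num
      _ ≤ _ := Real.exp_le_exp.2 (by linarith)
  have hL2 : L ^ 2 = Real.exp (2 * Real.log L) := by
    rw [two_mul, Real.exp_add, Real.exp_log hL0, sq]
  rw [mul_pow, mul_pow, Real.sq_sqrt two_pos.le, Real.sq_sqrt (by linarith), hL2]
  calc _ = 4 * (32 * Real.exp (2 * Real.log L) *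
        Real.exp (-(2 * (14 * 1 + τ) ^ 2 * Real.log L / (4 * Real.pi)))) := by ring
    _ ≤ 4 * (Real.exp (5 * Real.log L) * Real.exp (2 * Real.log L) *
        Real.exp (-(2 * (14 * 1 + τ) ^ 2 * Real.log L / (4 * Real.pi)))) := by gcongr
    _ ≤ _ := by
        rw [← Real.exp_add, ← Real.exp_add]
        gcongr
        have e1 : 2 * (14 * 1 + τ) ^ 2 * Real.log L / (4 * Real.pi) =
          τ ^ 2 / (2 * Real.pi) * Real.log L +
            (196 + 28 * τ) * Real.log L / (2 * Real.pi) := by field_simp; ring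
        have e2 : 7 * Real.log L ≤ (196 + 28 * τ) * Real.log L / (2 * Real.pi) := by
          rw [le_div_iff₀ (by positivity)]
          nlinarith [Real.pi_lt_four, mul_pos hτ (by linarith : 0 < Real.log L)]
        rw [e1]
        linarith

theorem isCompact_setOf_mem_box (L : ℝ) :
    IsCompact {p : ℝ × ℝ | (p.1 : ℂ) + p.2 * Complex.I ∈ box L} := by
  have : {p : ℝ × ℝ | (p.1 : ℂ) + p.2 * Complex.I ∈ box L} =
      Set.Icc (-L) L ×ˢ Set.Icc (-L) L := by
    ext p
    simp only [box, Set.mem_ofPred_eq, Complex.add_re, Complex.add_im, Complex.ofReal_re,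
      Complex.ofReal_im, Complex.re_ofReal_mul, Complex.im_ofReal_mul, Complex.I_re, Complex.I_im,
      mul_zero, mul_one, add_zero, zero_add, max_le_iff, abs_le, Set.mem_prod, Set.mem_Icc]
  rw [this]
  exact isCompact_Icc.prod isCompact_Icc

theorem stftDistribution_smul_add (amp : ℂ) (h f : 𝓢'(ℝ, ℂ)) (u v : ℝ) :
    stftDistribution gaussWindow (amp • h + f) u v =
      amp * stftDistribution gaussWindow h u v + stftDistribution gaussWindow f u v := rfl

section

variable {Ω : Type*} [MeasurableSpace Ω] {P : Measure Ω} {ξ : Ω → 𝓢'(ℝ, ℂ)}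

theorem IsWhiteNoise.holdsWithProbAtLeast_box [IsProbabilityMeasure P] (h : IsWhiteNoise P ξ)
    {L τ : ℝ} (hL : Real.pi ≤ L) (hτ : 0 < τ) :
    HoldsWithProbAtLeast P (1 - 4 * Real.exp (-(τ ^ 2 / (2 * Real.pi) * Real.log L)))
      (fun ω => ∀ z ∈ box L, ‖stftDistribution gaussWindow (ξ ω) z.re z.im‖ ≤
        √2 * (14 * 1 + τ) * √(Real.log L)) := by
  have hm : MeasurableSet {ω | ∀ z ∈ box L,
      ‖stftDistribution gaussWindow (ξ ω) z.re z.im‖ ≤ √2 * (14 * 1 + τ) * √(Real.log L)} := by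
    refine measurableSet_forall_mem_le
      (f := fun ω (z : ℂ) => ‖stftDistribution gaussWindow (ξ ω) z.re z.im‖)
      (fun z => (h.measurable_stft _ _).norm) (fun ω => ?_) _
    exact (Continuous.comp (g := fun p : ℝ × ℝ => stftDistribution gaussWindow (ξ ω) p.1 p.2)
      (f := fun z : ℂ => (z.re, z.im)) (continuous_stftDistribution_gaussWindow (ξ ω))
      (by fun_prop)).norm
  refine ⟨hm, ?_⟩
  have hc := probReal_compl_eq_one_sub (μ := P) hm
  have hb := h.measure_exists_box_le (L := L) (s := √2 * (14 * 1 + τ) * √(Real.log L))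
    (by linarith [Real.pi_gt_three]) (by positivity)
  have hb' : P.real {ω | ∀ z ∈ box L, ‖stftDistribution gaussWindow (ξ ω) z.re z.im‖ ≤
      √2 * (14 * 1 + τ) * √(Real.log L)}ᶜ ≤
      4 * Real.exp (-(τ ^ 2 / (2 * Real.pi) * Real.log L)) := by
    refine (ENNReal.toReal_le_of_le_ofReal (by positivity) (le_trans (measure_mono ?_) hb)).trans
      (box_tail_le hL hτ)
    intro ω hω
    simpa using hω
  rw [hc] at hb'
  exact sub_le_comm.1 hb'

end

end Gabor

end

theorem theorem2 :
    ∃ K : ℝ, 0 < K ∧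
      ∀ {Ω : Type*} [MeasurableSpace Ω] (P : Measure Ω) [IsProbabilityMeasure P]
        (ξ : Ω → 𝓢'(ℝ, ℂ)), Gabor.IsWhiteNoise P ξ →
        -- `K` is a constant in the bound for the Gabor transform of white noise
        (∀ L τ : ℝ, Real.pi ≤ L → 0 < τ →
          Gabor.HoldsWithProbAtLeast P (1 - 4 * Real.exp (-(τ ^ 2 / (2 * Real.pi) * Real.log L)))
            (fun ω => ∀ z ∈ Gabor.box L,
              ‖Gabor.stftDistribution Gabor.gaussWindow (ξ ω) z.re z.im‖ ≤
                √2 * (14 * K + τ) * √(Real.log L))) ∧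
        -- the level sets of the noisy fundamental mode `y = amp • h_k + ξ`
        (∀ (k : ℕ) (amp L τ : ℝ), 0 < τ → max √(k / Real.pi) Real.pi ≤ L →
          5 * √2 * (14 * K + τ) * √(Real.log L) / Gabor.peak k ≤ |amp| →
          ∀ α : ℝ, α = √2 * (14 * K + τ) * √(Real.log L) / (|amp| * Gabor.peak k) →
            α ∈ Set.Ioc (0 : ℝ) (1 / 5) ∧
            Gabor.HoldsWithProbAtLeast P
              (1 - 4 * Real.exp (-(τ ^ 2 / (2 * Real.pi) * Real.log L)))
              (fun ω =>
                (Gabor.levelSet ((amp : ℂ) • Gabor.hermiteDistribution k + ξ ω) L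
                  (3 * √2 * (14 * K + τ) * √(Real.log L))).Nonempty ∧
                Gabor.levelSet ((amp : ℂ) • Gabor.hermiteDistribution k + ξ ω) L
                  (3 * √2 * (14 * K + τ) * √(Real.log L)) ⊆
                  {p : ℝ × ℝ | α < ‖Gabor.stft Gabor.gaussWindow
                    (fun t => (Gabor.hermiteFun k t : ℂ)) p.1 p.2‖ / Gabor.peak k})) := by
  refine ⟨1, one_pos, fun {Ω} _ P _ ξ h => ⟨fun L τ hL hτ => h.holdsWithProbAtLeast_box hL hτ, ?_⟩⟩
  intro k amp L τ hτ hL hamp α hα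
  have hLπ : Real.pi ≤ L := (le_max_right _ _).trans hL
  have hlog : 0 < Real.log L := Real.log_pos (by linarith [Real.pi_gt_three])
  have hpk := Gabor.peak_pos k
  set s : ℝ := √2 * (14 * 1 + τ) * √(Real.log L) with hs
  have hs0 : 0 < s := by positivity
  have hamp5 : 5 * s ≤ |amp| * Gabor.peak k := by
    rw [div_le_iff₀ hpk] at hamp
    linarith
  have hc3 : 3 * √2 * (14 * 1 + τ) * √(Real.log L) = 3 * s := by rw [hs]; ring
  have hden : 0 < |amp| * Gabor.peak k := by linarith
  have hamp0 : 0 < |amp| := pos_of_mul_pos_left hden hpk.le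
  rw [hc3]
  refine ⟨⟨by rw [hα]; positivity,
    by rw [hα, div_le_div_iff₀ hden (by norm_num)]; linarith⟩, ?_, ?_⟩
  · -- the event is expressed by the existence of points of two compact sets in the level set
    have hm : ∀ p : ℝ × ℝ, Measurable fun ω => ‖Gabor.stftDistribution Gabor.gaussWindow
        ((amp : ℂ) • Gabor.hermiteDistribution k + ξ ω) p.1 p.2‖ := fun p => by
      simp only [Gabor.stftDistribution_smul_add]
      exact ((h.measurable_stft p.1 p.2).const_add _).norm
    have hcont : ∀ ω, Continuous fun p : ℝ × ℝ => ‖Gabor.stftDistribution Gabor.gaussWindow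
        ((amp : ℂ) • Gabor.hermiteDistribution k + ξ ω) p.1 p.2‖ := fun ω =>
      (Gabor.continuous_stftDistribution_gaussWindow _).norm
    have hbox := Gabor.isCompact_setOf_mem_box L
    have hcl : IsClosed {p : ℝ × ℝ | ‖Gabor.stft Gabor.gaussWindow
        (fun t => (Gabor.hermiteFun k t : ℂ)) p.1 p.2‖ / Gabor.peak k ≤ α} := by
      simp only [← Gabor.stftDistribution_hermiteDistribution]
      exact isClosed_le
        ((Gabor.continuous_stftDistribution_gaussWindow _).norm.div_const _) continuous_const
    refine ((Gabor.measurableSet_exists_mem_le hbox hm hcont (3 * s)).inter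
      (Gabor.measurableSet_exists_mem_le (hbox.inter_right hcl) hm hcont (3 * s)).compl).congr ?_
    ext ω
    refine and_congr Iff.rfl ⟨fun hne p hp => ?_, fun hsub hex => ?_⟩
    · by_contra hle
      rw [Set.mem_ofPred_eq] at hle
      exact hne ⟨p, ⟨hp.1, Set.mem_ofPred.2 (le_of_not_gt hle)⟩, hp.2⟩
    · obtain ⟨p, ⟨hpb, hple⟩, hp⟩ := hex
      exact not_lt_of_ge (Set.mem_ofPred.1 hple) (Set.mem_ofPred.1 (hsub ⟨hpb, hp⟩))
  · refine (h.holdsWithProbAtLeast_box hLπ hτ).2.trans (measureReal_mono fun ω hω => ?_)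
    have hω' : ∀ p : ℝ × ℝ, (p.1 : ℂ) + p.2 * Complex.I ∈ Gabor.box L →
        ‖Gabor.stftDistribution Gabor.gaussWindow (ξ ω) p.1 p.2‖ ≤ s := fun p hp => by
      have := hω _ hp
      have hre : ((p.1 : ℂ) + p.2 * Complex.I).re = p.1 := by simp
      have him : ((p.1 : ℂ) + p.2 * Complex.I).im = p.2 := by simp
      rwa [hre, him] at this
    refine ⟨⟨(√(k / Real.pi), 0), ?_⟩, fun p hp => ?_⟩
    · have hmem : (√(k / Real.pi) : ℂ) + (0 : ℝ) * Complex.I ∈ Gabor.box L := by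
        have : √(k / Real.pi) ≤ L := (le_max_left _ _).trans hL
        simpa only [Gabor.box, Set.mem_ofPred_eq, Complex.ofReal_zero, zero_mul, add_zero,
          Complex.ofReal_re, Complex.ofReal_im, abs_zero, abs_of_nonneg (Real.sqrt_nonneg _),
          max_eq_left (Real.sqrt_nonneg _)] using this
      refine ⟨hmem, ?_⟩
      have hn := hω' (√(k / Real.pi), 0) hmem
      rw [Gabor.stftDistribution_smul_add, Gabor.stftDistribution_hermiteDistribution]
      have ht := norm_sub_le_norm_add ((amp : ℂ) * Gabor.stft Gabor.gaussWindow
        (fun t => (Gabor.hermiteFun k t : ℂ)) (√(k / Real.pi)) 0)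
        (Gabor.stftDistribution Gabor.gaussWindow (ξ ω) (√(k / Real.pi)) 0)
      rw [norm_mul, Gabor.norm_stft_hermiteFun_eq_peak, Complex.norm_real, Real.norm_eq_abs] at ht
      linarith
    · obtain ⟨hpb, hp⟩ := hp
      have hn := hω' p hpb
      rw [Gabor.stftDistribution_smul_add, Gabor.stftDistribution_hermiteDistribution] at hp
      have ht := norm_add_le ((amp : ℂ) * Gabor.stft Gabor.gaussWindow
        (fun t => (Gabor.hermiteFun k t : ℂ)) p.1 p.2)
        (Gabor.stftDistribution Gabor.gaussWindow (ξ ω) p.1 p.2)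
      rw [norm_mul, Complex.norm_real, Real.norm_eq_abs] at ht
      change α < _ / _
      rw [hα, ← div_div, div_lt_div_iff_of_pos_right hpk, div_lt_iff₀ hamp0]
      linarith
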